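/- Let $I,J\subseteq[n]$, write $\overline J=\{\overline j: j\in J\}$, and order $[n]\sqcup[\overline n]$ by $1\prec\overline1\prec2\prec\overline2\prec\cdots\prec n\prec\overline n$. Assume that $(I,\overline J)$ is valid: $\min(I\sqcup\overline J)\in I$ and $\max(I\sqcup\overline J)\in\overline J$. *Graphs.* Let $A=A(I,\overline J)$ be the set of arcs $(i,\overline j)$ with $i\in I$, $\overline j\in\overline J$, $i\prec\overline j$. For $\overline j\in\overline J$ let $\mathrm{prec}(\overline j)=i$ if $\overline j$ is immediately preceded in $I\sqcup\overline J$ by an element $i\in I$, and $\mathrm{prec}(\overline j)=j$ otherwise. Let $G=G(I,\overline J)$ be the graph on $I\cup\mathrm{prec}(\overline J)$ obtained from the edges $(i,\mathrm{prec}(\overline j))$ with $i\in I$, $\overline j\in \overline J$, $i<\mathrm{prec}(\overline j)$ by removing each edge $(v,w)$ for which there is a directed path from $v$ to $w$ with at least two edges. Let $\widehat G$ be obtained from $G$ by adding vertices $s,t$ and the edges $(s,i)$ for $i\in I$ and $(\mathrm{prec}(\overline j),t)$ for $\overline j\in\overline J$. *Polytopes.* Let $\mathcal F_{\widehat G}\subseteq\mathbb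 R^{E(\widehat G)}$ be the polytope of nonnegative flows on $\widehat G$ with net flow $1$ at $s$, $-1$ at $t$ and $0$ at all other vertices. Let $\mathcal U_{I,\overline J}=\mathrm{conv}\{(e_i,e_{\overline j}):(i,\overline j)\in A\}\subseteq\mathbb R^{2n}$. Let $\varphi_1:\mathbb R^{E(\widehat G)}\to\mathbb R^{2n}$ be the linear map with $e_{(s,i)}\mapsto(e_i,0)$, $e_{(\mathrm{prec}(\overline j),t)}\mapsto(0,e_{\overline j})$, and $e_{(v,w)}\mapsto 0$ for $(v,w)\in E(G)$. *The Tamari complex.* Two arcs $(i,\overline j),(i',\overline j')$ cross if $i\prec i'\prec\overline j\prec\overline j'$. The $(I,\overline J)$-Tamari complex is the simplicial complex on the arcs of $A$ whose faces are the nonempty sets of pairwise non-crossing arcs, the $(I,\overline J)$-forests. The $(I,\overline J)$-associahedral triangulation of $\mathcal U_{I,\overline J}$ is the one whose simplices are $\mathrm{conv}\{(e_i,e_{\overline j}):(i,\overline j)\in F\}$ for the nonempty $(I,\overline J)$-forests $F$. *Reductions.* Let $M_G=\prod_{(i,j)\in E(G)}x_{ij}$. A reduction of a polynomial over $\mathbb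 Z[\beta]$ in the variables $x_{ij}$ at $i<j<k$ replaces the factor $x_{ij}x_{jk}$ by $x_{ik}x_{ij}+x_{jk}x_{ik}+\beta x_{ik}$ in every monomial divisible by it. A monomial is identified with the graph whose edges are the $(i,j)$ such that $x_{ij}$ divides it. The edges $(i,j),(j,k)$ with $i<j<k$ form a longest pair at $j$ in a graph if it has no edge $(i',j)$ with $i'<i$ and no edge $(j,k')$ with $k'>k$. In the length reduction order every step reduces, in each monomial it changes, the longest pair with minimal $j$; more generally one may allow any order in which each step reduces, in each monomial it changes, a longest pair. A reduced form is the polynomial at the end of a sequence of reductions, when no reduction is possible. A monomial $m$ of a reduced form $p$ encodes the simplex in $\mathcal F_{\widehat G}$ whose vertices are the unit flows along the routes $s,P,t$, where $P$ is the path in $G$ from $v$ to $w$ for an edge $(v,w)$ of the graph of $m$, and along the routes $s,v,t$ with $v\in I\cap\mathrm{prec}(\overline J)$. **Theorem.** A reduced form of $M_G$ in the length reduction order exists. Let $p$ be such a reduced form, or, more generally, one obtained by reducing longest pairs at every step. Then the simplices encoded by the monomials of $p$, with all their faces, form a triangulation $\mathscr T_{len}$ of $\mathcal F_{\widehat G}$,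 whose facets are exactly the simplices encoded by the monomials of $p$ of highest degree $|E(G)|$ in the $x_{ij}$. The map $\varphi_1$ restricts to a bijection $\mathcal F_{\widehat G}\to\mathcal U_{I,\overline J}$ and carries the simplices of $\mathscr T_{len}$ exactly onto the simplices of the $(I,\overline J)$-associahedral triangulation of $\mathcal U_{I,\overline J}$ (in particular the latter is a triangulation). Consequently $\mathscr T_{len}$ is a geometric realization of the $(I,\overline J)$-Tamari complex: there is an injective assignment of points to the arcs of $A$ that carries the faces of the complex exactly to the faces of $\mathscr T_{len}$. -/

import Mathlib

/-! The label set `[n]` is `Fin n` (with its order), and `[n] ⊔ [n̄]` is `Fin n ⊕ Fin n`: `inl i` is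
the element `i` and `inr j` is the element `j̄`. A pair `(I, J̄)` is given by `I J : Finset (Fin n)`. -/

noncomputable section

namespace IJTamari

/-! ### Pairs `(I, J̄)` and the graph `A(I, J̄)` -/

/-- Position in the total order `1 ≺ 1̄ ≺ 2 ≺ 2̄ ≺ ⋯ ≺ n ≺ n̄`. -/
def pos {n : ℕ} : Fin n ⊕ Fin n → ℕ
  | Sum.inl i => 2 * i.val
  | Sum.inr j => 2 * j.val + 1

/-- The strict total order `≺` on `[n] ⊔ [n̄]`. -/
def Prec {n : ℕ} (x y : Fin n ⊕ Fin n) : Prop := pos x < pos y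

/-- `I ⊔ J̄`. -/
def nodes {n : ℕ} (I J : Finset (Fin n)) : Finset (Fin n ⊕ Fin n) := I.disjSum J

/-- `(I, J̄)` is valid: the minimum of `I ⊔ J̄` lies in `I` and its maximum lies in `J̄`. -/
def Valid {n : ℕ} (I J : Finset (Fin n)) : Prop :=
  (∃ i ∈ I, ∀ x ∈ nodes I J, ¬ Prec x (Sum.inl i)) ∧
  (∃ j ∈ J, ∀ x ∈ nodes I J, ¬ Prec (Sum.inr j) x)

/-- `i` is an element of `I` which immediately precedes `j̄` in the order induced on `I ⊔ J̄`. -/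
def ImmPrecedes {n : ℕ} (I J : Finset (Fin n)) (i j : Fin n) : Prop :=
  i ∈ I ∧ Prec (Sum.inl i) (Sum.inr j) ∧
    ∀ x ∈ nodes I J, ¬ (Prec (Sum.inl i) x ∧ Prec x (Sum.inr j))

open Classical in
/-- `prec(j̄)`: the element of `I` immediately preceding `j̄` in `I ⊔ J̄` if there is one, and `j`
otherwise. -/
def prec {n : ℕ} (I J : Finset (Fin n)) (j : Fin n) : Fin n :=
  if h : ∃ i, ImmPrecedes I J i j then h.choose else j

open Classical in
/-- The edges (arcs) `(i, j̄)`, `i ∈ I`, `j̄ ∈ J̄`, `i ≺ j̄` of the graph `A(I, J̄)`. -/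
def arcs {n : ℕ} (I J : Finset (Fin n)) : Finset (Fin n × Fin n) :=
  (I ×ˢ J).filter fun a => Prec (Sum.inl a.1) (Sum.inr a.2)

/-! ### The graph `G(I, J̄)`

Graphs are finite sets of edges, each directed from the smaller to the larger vertex. -/

/-- The edges `(i, prec(j̄))`, `i < prec(j̄)`, of the quotient graph `prec(A(I, J̄))`. -/
def precEdges {n : ℕ} (I J : Finset (Fin n)) : Finset (Fin n × Fin n) :=
  (I ×ˢ J.image (prec I J)).filter fun e => e.1 < e.2

open Classical in
/-- The minimal graph of `H`: remove every edge `(i, j)` for which `H` has a directed path from `i`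
to `j` with at least one intermediate vertex. -/
def minGraph {V : Type*} (H : Finset (V × V)) : Finset (V × V) :=
  H.filter fun e =>
    ¬ ∃ v, (e.1, v) ∈ H ∧ Relation.TransGen (fun a b => (a, b) ∈ H) v e.2

/-- The edge set of `G(I, J̄)`. Its vertex set is `I ∪ prec(J̄)`. -/
def graphG {n : ℕ} (I J : Finset (Fin n)) : Finset (Fin n × Fin n) := minGraph (precEdges I J)

/-! ### The partially augmented graph `Ĝ(I, J̄)` and its flow polytope -/

/-- Vertices of augmented graphs: `s = ⊥`, then `[n]`, then `t = ⊤`. -/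
abbrev AugVertex (n : ℕ) : Type := WithBot (WithTop (Fin n))

/-- A vertex of `[n]` as a vertex of the augmented graph. -/
def innerV {n : ℕ} (i : Fin n) : AugVertex n := ((i : WithTop (Fin n)) : WithBot (WithTop (Fin n)))

/-- The edge set of `Ĝ(I, J̄)`: the edges of `G(I, J̄)`, the edges `(s, i)` with `i ∈ I`, and the
edges `(prec(j̄), t)` with `j̄ ∈ J̄`. -/
def augEdges {n : ℕ} (I J : Finset (Fin n)) : Finset (AugVertex n × AugVertex n) :=
  (graphG I J).image (fun e => (innerV e.1, innerV e.2)) ∪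
    I.image (fun i => (⊥, innerV i)) ∪
    J.image (fun j => (innerV (prec I J j), ⊤))

/-- The flow polytope of a directed graph with unit net flow from `s` to `t`: nonnegative edge
weights whose outgoing minus incoming total at each vertex is that of `e_s - e_t`. -/
def flowPolytope {V : Type*} [DecidableEq V] (E : Finset (V × V)) (s t : V) : Set (E → ℝ) :=
  {x | (∀ e, 0 ≤ x e) ∧
    ∀ v : V, (∑ e : E with e.1.1 = v, x e) - (∑ e : E with e.1.2 = v, x e) =
      (if v = s then 1 else 0) - (if v = t then 1 else 0)}

/-- `F_Ĝ` for `Ĝ = Ĝ(I, J̄)`, inside `ℝ^{E(Ĝ)}`. -/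
def flowPoly {n : ℕ} (I J : Finset (Fin n)) : Set (augEdges I J → ℝ) :=
  flowPolytope (augEdges I J) ⊥ ⊤

/-- `P` is the vertex sequence of a directed path from `v` to `w` with edges in `H`
(the sequence `[v]` is the trivial path from `v` to itself). -/
def IsPath {V : Type*} (H : Finset (V × V)) (v w : V) (P : List V) : Prop :=
  P.IsChain (fun a b => (a, b) ∈ H) ∧ P.head? = some v ∧ P.getLast? = some w

/-- The unit flow along the route `s, P, t` of `Ĝ(I, J̄)`, as a point of `ℝ^{E(Ĝ)}`. -/
def routeFlow {n : ℕ} (I J : Finset (Fin n)) (P : List (Fin n)) : augEdges I J → ℝ :=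
  let R : List (AugVertex n) := ⊥ :: (P.map innerV ++ [⊤])
  fun e => if e.1 ∈ R.zip R.tail then 1 else 0

/-- The points spanning the polytope `F_{Ĝ_N}` of a graph `N` obtained from `G = G(I, J̄)` by
reductions: the routes `s, P, t`, where `P` is the path of `G` that an edge `(v, w)` of `N` stands
for (there is just one path from `v` to `w` in `G`), and the routes `s, i, t` of `Ĝ`. -/
def spanningRoutes {n : ℕ} (I J : Finset (Fin n)) (N : Finset (Fin n × Fin n)) :
    Set (augEdges I J → ℝ) :=
  {x | ∃ e ∈ N, ∃ P, IsPath (graphG I J) e.1 e.2 P ∧ x = routeFlow I J P} ∪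
  {x | ∃ i ∈ I, i ∈ J.image (prec I J) ∧ x = routeFlow I J [i]}

/-! ### Reductions in the subdivision algebra -/

/-- Polynomials in the generators `x_{ij}` over `ℤ[β]`; only the `x_{ij}` with `i < j` will occur. -/
abbrev SubdivPoly (n : ℕ) : Type := MvPolynomial (Fin n × Fin n) (Polynomial ℤ)

/-- The parameter `β`. -/
def beta (n : ℕ) : SubdivPoly n := MvPolynomial.C Polynomial.X

/-- The exponent vector of `x_{ij} x_{jk}`. -/
def pairExp {n : ℕ} (i j k : Fin n) : (Fin n × Fin n) →₀ ℕ :=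
  Finsupp.single (i, j) 1 + Finsupp.single (j, k) 1

open Classical in
/-- Substitute, in every monomial of `p` divisible by `x_{ij} x_{jk}`, this factor by
`x_{ik} x_{ij} + x_{jk} x_{ik} + β x_{ik}`. -/
def reduceAt {n : ℕ} (i j k : Fin n) (p : SubdivPoly n) : SubdivPoly n :=
  ∑ m ∈ p.support,
    if pairExp i j k ≤ m then
      MvPolynomial.monomial (m - pairExp i j k) (p.coeff m) *
        (MvPolynomial.X (i, k) * MvPolynomial.X (i, j) +
          MvPolynomial.X (j, k) * MvPolynomial.X (i, k) + beta n * MvPolynomial.X (i, k))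
    else MvPolynomial.monomial m (p.coeff m)

/-- The graph of a monomial: the edges `(i, j)` such that `x_{ij}` divides it. -/
def graphOf {n : ℕ} (m : (Fin n × Fin n) →₀ ℕ) : Finset (Fin n × Fin n) := m.support

/-- `(i, j)`, `(j, k)` is a non-alternating pair of edges of `H`. -/
def NonAlternating {n : ℕ} (H : Finset (Fin n × Fin n)) (i j k : Fin n) : Prop :=
  i < j ∧ j < k ∧ (i, j) ∈ H ∧ (j, k) ∈ H

/-- `(i, j)`, `(j, k)` is a longest pair of `H` at `j`. -/
def LongestPair {n : ℕ} (H : Finset (Fin n × Fin n)) (i j k : Fin n) : Prop :=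
  NonAlternating H i j k ∧
    (¬ ∃ i', i' < i ∧ (i', j) ∈ H) ∧ (¬ ∃ k', k < k' ∧ (j, k') ∈ H)

/-- `q` is a reduction of `p` at a pair of edges which is a longest pair (at its middle vertex) in
every monomial that is being reduced. -/
def LongestPairStep {n : ℕ} (p q : SubdivPoly n) : Prop :=
  ∃ i j k : Fin n,
    (∃ m ∈ p.support, NonAlternating (graphOf m) i j k) ∧
    (∀ m ∈ p.support, NonAlternating (graphOf m) i j k → LongestPair (graphOf m) i j k) ∧
    q = reduceAt i j k p

/-- A step of the length reduction order: `q` is a reduction of `p` at a pair of edges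
`(i, j)`, `(j, k)` which, in every monomial that is being reduced, is the longest pair with
minimal `j`. -/
def LengthOrderStep {n : ℕ} (p q : SubdivPoly n) : Prop :=
  ∃ i j k : Fin n,
    (∃ m ∈ p.support, NonAlternating (graphOf m) i j k) ∧
    (∀ m ∈ p.support, NonAlternating (graphOf m) i j k →
      LongestPair (graphOf m) i j k ∧
        ∀ i' j' k', LongestPair (graphOf m) i' j' k' → j ≤ j') ∧
    q = reduceAt i j k p

/-- No reduction is possible in `p`. -/
def IsReduced {n : ℕ} (p : SubdivPoly n) : Prop :=
  ∀ m ∈ p.support, ∀ i j k : Fin n, ¬ NonAlternating (graphOf m) i j k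

/-- The monomial `M_G` of `G = G(I, J̄)`. -/
def monomialG {n : ℕ} (I J : Finset (Fin n)) : SubdivPoly n :=
  ∏ e ∈ graphG I J, MvPolynomial.X e

/-- `p` is a reduced form of `M_G` obtained by the length reduction order. -/
def IsLengthReducedForm {n : ℕ} (I J : Finset (Fin n)) (p : SubdivPoly n) : Prop :=
  Relation.ReflTransGen LengthOrderStep (monomialG I J) p ∧ IsReduced p

/-- `p` is a reduced form of `M_G` obtained by reducing a longest pair at every step. -/
def IsLongestPairReducedForm {n : ℕ} (I J : Finset (Fin n)) (p : SubdivPoly n) : Prop :=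
  Relation.ReflTransGen LongestPairStep (monomialG I J) p ∧ IsReduced p

/-! ### Triangulations -/

/-- `T` triangulates the set `P`. -/
def IsTriangulation {E : Type*} [AddCommGroup E] [Module ℝ E]
    (T : Geometry.SimplicialComplex ℝ E) (P : Set E) : Prop := T.space = P

/-- `T` is the triangulation of `F_Ĝ` encoded by the reduced form `p`: it triangulates `F_Ĝ`, its
simplices are those spanned by the routes of the monomials of `p` together with their faces, and its
facets are those of the monomials of highest degree `|E(G)|`. -/
def IsEncodedTriangulation {n : ℕ} (I J : Finset (Fin n)) (p : SubdivPoly n)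
    (T : Geometry.SimplicialComplex ℝ (augEdges I J → ℝ)) : Prop :=
  IsTriangulation T (flowPoly I J) ∧
  T.faces = {σ : Finset (augEdges I J → ℝ) | σ.Nonempty ∧ ∃ m ∈ p.support, (σ : Set _) ⊆ spanningRoutes I J (graphOf m)} ∧
  T.facets = {σ : Finset (augEdges I J → ℝ) | ∃ m ∈ p.support, m.degree = (graphG I J).card ∧
    (σ : Set _) = spanningRoutes I J (graphOf m)}

/-! ### The polytope `U_{I,J̄}`, the map `φ₁` and the `(I, J̄)`-Tamari complex -/

/-- The arcs `a` and `b` satisfy `i ≺ i' ≺ j̄ ≺ j̄'`, where `a = (i, j̄)` and `b = (i', j̄')`. -/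
def Crosses {n : ℕ} (a b : Fin n × Fin n) : Prop :=
  Prec (Sum.inl a.1) (Sum.inl b.1) ∧ Prec (Sum.inl b.1) (Sum.inr a.2) ∧
    Prec (Sum.inr a.2) (Sum.inr b.2)

/-- A set of arcs of `A(I, J̄)` is (the arc set of) an `(I, J̄)`-forest if it is non-crossing. -/
def IsForest {n : ℕ} {I J : Finset (Fin n)} (F : Finset (arcs I J)) : Prop :=
  ∀ a ∈ F, ∀ b ∈ F, ¬ Crosses a.1 b.1

/-- The `(I, J̄)`-Tamari complex: the flag simplicial complex on the arcs of `A(I, J̄)` whose faces are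
the (nonempty) `(I, J̄)`-forests, so that its minimal non-faces are the pairs of crossing arcs. -/
def tamariComplex {n : ℕ} (I J : Finset (Fin n)) : AbstractSimplicialComplex (arcs I J) where
  faces := {F | F.Nonempty ∧ IsForest F}
  isRelLowerSet_faces := fun _ hF =>
    ⟨hF.1, fun _ hsub hne => ⟨hne, fun a ha b hb => hF.2 a (hsub ha) b (hsub hb)⟩⟩
  singleton_mem := fun v => by
    refine ⟨Finset.singleton_nonempty v, fun a ha b hb h => ?_⟩
    rw [Finset.mem_singleton] at ha hb
    subst ha hb
    exact lt_irrefl _ h.1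

/-- The point `(e_i, e_j̄)` of `ℝ^{2n}`, for the arc `(i, j̄)`. -/
def arcPoint {n : ℕ} (a : Fin n × Fin n) : (Fin n → ℝ) × (Fin n → ℝ) :=
  (Pi.single a.1 1, Pi.single a.2 1)

/-- The polytope `U_{I,J̄}`. -/
def polytopeU {n : ℕ} (I J : Finset (Fin n)) : Set ((Fin n → ℝ) × (Fin n → ℝ)) :=
  convexHull ℝ (arcPoint '' (arcs I J : Set (Fin n × Fin n)))

open Classical in
/-- The linear map `φ₁ : ℝ^{E(Ĝ)} → ℝ^{2n}` with `φ₁(e_{(s,i)}) = (e_i, 0)`,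
`φ₁(e_{(prec(j̄),t)}) = (0, e_j̄)` for `j̄ ∈ J̄`, and `φ₁(e) = 0` for all other edges. -/
def phi1 {n : ℕ} (I J : Finset (Fin n)) :
    (augEdges I J → ℝ) →ₗ[ℝ] (Fin n → ℝ) × (Fin n → ℝ) :=
  Fintype.linearCombination ℝ fun e : augEdges I J =>
    ((fun i => if e.1 = (⊥, innerV i) then (1 : ℝ) else 0),
      (fun j => if j ∈ J ∧ e.1 = (innerV (prec I J j), ⊤) then (1 : ℝ) else 0))

open Classical in
/-- `T` is a geometric realization of the abstract simplicial complex `K`: some injection of the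
vertices of `K` into the ambient space carries the faces of `K` to those of `T`. -/
def IsGeometricRealization {ι E : Type*} [AddCommGroup E] [Module ℝ E]
    (K : AbstractSimplicialComplex ι) (T : Geometry.SimplicialComplex ℝ E) : Prop :=
  ∃ f : ι → E, Function.Injective f ∧ T.faces = (fun F => F.image f) '' K.faces

open Classical in
/-- `A` is the `(I, J̄)`-associahedral triangulation of `U_{I,J̄}`: its simplices are the
`conv {(e_i, e_j̄) | (i, j̄) ∈ F}` for the faces `F` of the `(I, J̄)`-Tamari complex. -/
def IsAssociahedralTriangulation {n : ℕ} (I J : Finset (Fin n))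
    (A : Geometry.SimplicialComplex ℝ ((Fin n → ℝ) × (Fin n → ℝ))) : Prop :=
  IsTriangulation A (polytopeU I J) ∧
  A.faces = (fun F => F.image fun a : arcs I J => arcPoint a.1) '' (tamariComplex I J).faces

open Classical in
/-- The linear map `φ` carries the triangulation `T` of `P` to the triangulation `A` of `Q`: it maps
`P` bijectively onto `Q` and the simplices of `T` to exactly the simplices of `A`. -/
def CarriesTo {E E' : Type*} [AddCommGroup E] [Module ℝ E] [AddCommGroup E'] [Module ℝ E']
    (φ : E →ₗ[ℝ] E') (T : Geometry.SimplicialComplex ℝ E) (P : Set E)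
    (A : Geometry.SimplicialComplex ℝ E') (Q : Set E') : Prop :=
  Set.BijOn φ P Q ∧ A.faces = (fun σ => σ.image φ) '' T.faces

end IJTamari

end

open IJTamari

/-!
The vertices of `G = G(I, J̄)` are the sources `I` and the sinks `W = prec(J̄)`, and `(i, j̄)` is an
arc exactly when `i ≤ prec(j̄)`; so arcs are source-sink pairs `i ≤ w`, and the pairs `(b, b)` with
`b ∈ I ∩ W` cross no other arc. Between an element of `I` and a later sink outside `I` there is
always some `b ∈ I ∩ W` (`exists_mem_inter_of_lt`). Hence the edges of `G` are the source-sink pairs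
that do not jump over an element of `I ∩ W` (`mem_graphG`), `G` is a forest drawn without crossings
(`isNoncrossingForest_graphG`), and every arc is joined by a path of `G`, that is, has a route.

*Reductions.* Reducing a longest pair `(i, j)`, `(j, k)` of a noncrossing forest `N` gives
noncrossing forests (`IsNoncrossingForest.exchange`). A source-sink path of `N` that is lost on
exchanging `(j, k)` for `(i, k)` and one that is lost on exchanging `(i, j)` for `(i, k)` are
crossing arcs, so a noncrossing set of paths of `N` survives in one of the two graphs
(`IsNoncrossingForest.reach_exchange`). Since coefficients stay nonnegative nothing cancels, and at
the end every `(I, J̄)`-forest lies in the graph of a monomial of highest degree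
(`IsPartialReduction.exists_subset_arcsOf`), while that graph, being alternating and noncrossing, is
itself an `(I, J̄)`-forest. A reduced form in the length order exists because longer edges weigh
less, so that a suitable weight drops at each step (`exists_lengthOrderStep`).

*Geometry.* A nonnegative matrix supported on noncrossing arcs is determined by its row and column
sums (`eq_of_marginals`), and every pair of marginals with dominating partial sums is attained by
matching the up- and down-steps of a lattice path (`exists_noncrossing`). The first fact makes the
simplices of the Tamari complex fit together in `U_{I,J̄}`, and the second makes them cover it.
Both are transported to the flow polytope by `φ₁`: it is injective there because `G` is a forest
(`injOn_phi1`), it maps the route of an arc to the point of that arc (`phi1_arcFlow`), and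
the marginals of a flow have dominating partial sums because flow only moves to the right
(`sum_phi1_le`).
-/

noncomputable section

namespace IJTamari

variable {n : ℕ} {I J : Finset (Fin n)}

/-! ### The word `I ⊔ J̄` and the graph `G(I, J̄)` -/

/-- `prec(J̄)`. -/
def precSet (I J : Finset (Fin n)) : Finset (Fin n) := J.image (prec I J)

lemma prec_cases (I J : Finset (Fin n)) (j : Fin n) :
    ImmPrecedes I J (prec I J j) j ∨
      (prec I J j = j ∧ ¬ ∃ i, ImmPrecedes I J i j) := by
  unfold prec
  split_ifs with h
  · exact Or.inl h.choose_spec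
  · exact Or.inr ⟨rfl, h⟩

lemma immPrecedes_iff {I J : Finset (Fin n)} {i j : Fin n} :
    ImmPrecedes I J i j ↔ i ∈ I ∧ i ≤ j ∧ (∀ i' ∈ I, i < i' → ¬ i' ≤ j) ∧
      (∀ j' ∈ J, i ≤ j' → ¬ j' < j) := by
  simp only [ImmPrecedes, Prec, pos, nodes, Sum.forall, Finset.inl_mem_disjSum,
    Finset.inr_mem_disjSum, Fin.le_def, Fin.lt_def]
  constructor
  · rintro ⟨h1, h2, h3, h4⟩
    refine ⟨h1, by omega, fun i' hi' h => ?_, fun j' hj' h => ?_⟩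
    · have := h3 i' hi'; omega
    · have := h4 j' hj'; omega
  · rintro ⟨h1, h2, h3, h4⟩
    refine ⟨h1, by omega, fun i' hi' h => ?_, fun j' hj' h => ?_⟩
    · have := h3 i' hi'; omega
    · have := h4 j' hj'; omega

lemma prec_le (I J : Finset (Fin n)) (j : Fin n) : prec I J j ≤ j := by
  rcases prec_cases I J j with h | h
  · exact (immPrecedes_iff.1 h).2.1
  · exact h.1.le

lemma le_prec_iff {I J : Finset (Fin n)} {i : Fin n} (hi : i ∈ I) (j : Fin n) :
    i ≤ prec I J j ↔ i ≤ j := by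
  refine ⟨fun h => h.trans (prec_le I J j), fun h => ?_⟩
  rcases prec_cases I J j with h' | h'
  · have := (immPrecedes_iff.1 h').2.2.1 i hi
    by_contra hc
    exact this (not_le.1 hc) h
  · rw [h'.1]; exact h

lemma lt_prec_of_lt {I J : Finset (Fin n)} {j j' : Fin n} (hj : j ∈ J) (h : j < j') :
    j < prec I J j' := by
  rcases prec_cases I J j' with h' | h'
  · have := (immPrecedes_iff.1 h').2.2.2 j hj
    by_contra hc
    exact this (not_lt.1 hc) h
  · rw [h'.1]; exact h

lemma prec_lt_prec_iff {I J : Finset (Fin n)} {j j' : Fin n} (hj : j ∈ J) (hj' : j' ∈ J) :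
    prec I J j < prec I J j' ↔ j < j' := by
  have key : ∀ {a b : Fin n}, a ∈ J → a < b → prec I J a < prec I J b := fun ha h =>
    (prec_le I J _).trans_lt (lt_prec_of_lt ha h)
  refine ⟨fun h => ?_, key hj⟩
  rcases lt_trichotomy j j' with h' | h' | h'
  · exact h'
  · subst h'; exact absurd h (lt_irrefl _)
  · exact absurd (h.trans (key hj' h')) (lt_irrefl _)

lemma prec_injOn (I J : Finset (Fin n)) : Set.InjOn (prec I J) J := by
  intro j hj j' hj' h
  rcases lt_trichotomy j j' with h' | h' | h'
  · exact absurd h ((prec_lt_prec_iff hj hj').2 h').ne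
  · exact h'
  · exact absurd h ((prec_lt_prec_iff hj' hj).2 h').ne'

/-- Between an element of `I` and a later sink of the graph that is not in `I`, the word `I ⊔ J̄`
has an element of `I` followed at once by an element of `J̄`: this makes `G(I, J̄)` a tree. -/
lemma exists_mem_inter_of_lt {I J : Finset (Fin n)} {i w : Fin n} (hi : i ∈ I)
    (hw : w ∈ precSet I J) (hwI : w ∉ I) (h : i < w) :
    ∃ b ∈ I, b ∈ precSet I J ∧ i ≤ b ∧ b < w := by
  obtain ⟨j, hj, rfl⟩ := Finset.mem_image.1 hw
  rcases prec_cases I J j with h' | ⟨h1, h2⟩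
  · exact absurd (immPrecedes_iff.1 h').1 hwI
  rw [h1] at h hwI ⊢
  -- `b` is the last element of `I` before `j`, and `k` the first element of `J` after `b`
  obtain ⟨b, hb, hbmax⟩ := (I.filter (fun x => x ≤ j)).exists_max_image id
    ⟨i, Finset.mem_filter.2 ⟨hi, h.le⟩⟩
  obtain ⟨k, hk, hkmin⟩ := (J.filter (fun x => b ≤ x)).exists_min_image id
    ⟨j, Finset.mem_filter.2 ⟨hj, (Finset.mem_filter.1 hb).2⟩⟩
  simp only [Finset.mem_filter, id, and_imp] at hb hbmax hk hkmin
  have hbj : b < j := lt_of_le_of_ne hb.2 (fun e => hwI (e ▸ hb.1))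
  have hkj : k ≤ j := hkmin j hj hb.2
  refine ⟨b, hb.1, Finset.mem_image.2 ⟨k, hk.1, ?_⟩, hbmax i hi h.le, hbj⟩
  have hbk : ImmPrecedes I J b k := by
    rw [immPrecedes_iff]
    refine ⟨hb.1, hk.2, fun i' hi' hlt hle => ?_, fun j' hj' hle hlt => ?_⟩
    · exact absurd (hbmax i' hi' (hle.trans hkj)) (not_le.2 hlt)
    · exact absurd (hkmin j' hj' hle) (not_le.2 hlt)
  refine le_antisymm ?_ ((le_prec_iff hb.1 k).2 hk.2)
  rcases prec_cases I J k with h3 | h3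
  · by_contra hc
    exact (immPrecedes_iff.1 hbk).2.2.1 _ (immPrecedes_iff.1 h3).1 (not_le.1 hc)
      (immPrecedes_iff.1 h3).2.1
  · exact absurd ⟨b, hbk⟩ h3.2

lemma exists_mem_inter_of_lt' {I J : Finset (Fin n)} {i w : Fin n} (hi : i ∈ I)
    (hw : w ∈ precSet I J) (hiW : i ∉ precSet I J) (h : i < w) :
    ∃ b ∈ I, b ∈ precSet I J ∧ i < b ∧ b ≤ w := by
  by_cases hwI : w ∈ I
  · exact ⟨w, hwI, hw, h, le_rfl⟩
  · obtain ⟨b, h1, h2, h3, h4⟩ := exists_mem_inter_of_lt hi hw hwI h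
    exact ⟨b, h1, h2, lt_of_le_of_ne h3 (fun e => hiW (e ▸ h2)), h4.le⟩

/-- A valid pair has a vertex which is both a source and a sink. -/
lemma Valid.exists_mem_inter {I J : Finset (Fin n)} (h : Valid I J) :
    ∃ b ∈ I, b ∈ precSet I J := by
  obtain ⟨⟨i, hi, hmin⟩, ⟨j, hj, -⟩⟩ := h
  have hij : i ≤ j := by
    have := hmin (Sum.inr j) (by simp [nodes, hj])
    simp only [Prec, pos] at this
    rw [Fin.le_def]; omega
  have hw : prec I J j ∈ precSet I J := Finset.mem_image_of_mem _ hj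
  by_cases hwI : prec I J j ∈ I
  · exact ⟨_, hwI, hw⟩
  · obtain ⟨b, h1, h2, -⟩ := exists_mem_inter_of_lt hi hw hwI
      (lt_of_le_of_ne ((le_prec_iff hi j).2 hij) (fun e => hwI (e ▸ hi)))
    exact ⟨b, h1, h2⟩

lemma mem_precEdges {I J : Finset (Fin n)} {v w : Fin n} :
    (v, w) ∈ precEdges I J ↔ v ∈ I ∧ w ∈ precSet I J ∧ v < w := by
  simp [precEdges, precSet, and_assoc]

/-- The edges of `G(I, J̄)` are those pairs of a source and a sink which do not jump over a vertex
that is both a source and a sink. -/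
lemma mem_graphG {I J : Finset (Fin n)} {v w : Fin n} :
    (v, w) ∈ graphG I J ↔ v ∈ I ∧ w ∈ precSet I J ∧ v < w ∧
      ∀ b ∈ I, b ∈ precSet I J → v < b → ¬ b < w := by
  have hlt : ∀ {x y : Fin n},
      Relation.TransGen (fun a b => (a, b) ∈ precEdges I J) x y → x < y := by
    intro x y hxy
    induction hxy with
    | single h => exact (mem_precEdges.1 h).2.2
    | tail _ h ih => exact ih.trans (mem_precEdges.1 h).2.2
  simp only [graphG, minGraph, Finset.mem_filter]
  rw [mem_precEdges]
  constructor
  · rintro ⟨⟨hv, hw, hvw⟩, h⟩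
    refine ⟨hv, hw, hvw, fun b hb hbW h1 h2 => h ⟨b, ?_, Relation.TransGen.single ?_⟩⟩
    · exact mem_precEdges.2 ⟨hv, hbW, h1⟩
    · exact mem_precEdges.2 ⟨hb, hw, h2⟩
  · rintro ⟨hv, hw, hvw, h⟩
    refine ⟨⟨hv, hw, hvw⟩, ?_⟩
    rintro ⟨b, h1, h2⟩
    obtain ⟨c, hc, -⟩ := Relation.TransGen.head'_iff.1 h2
    exact h b (mem_precEdges.1 hc).1 (mem_precEdges.1 h1).2.1 (mem_precEdges.1 h1).2.2 (hlt h2)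

/-! ### Longest reductions of noncrossing forests -/

/-- `w` can be reached from `v` by a directed path with at least one edge of `N`. -/
def Reach (N : Finset (Fin n × Fin n)) : Fin n → Fin n → Prop :=
  Relation.TransGen fun a b => (a, b) ∈ N

lemma reach_graphG {I J : Finset (Fin n)} {v w : Fin n} (hv : v ∈ I) (hw : w ∈ precSet I J)
    (h : v < w) : Reach (graphG I J) v w := by
  induction hd : w.val - v.val using Nat.strong_induction_on generalizing v w with
  | _ d ih =>
    by_cases hG : (v, w) ∈ graphG I J
    · exact Relation.TransGen.single hG
    · rw [mem_graphG] at hG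
      push Not at hG
      obtain ⟨b, hb, hbW, h1, h2⟩ := hG hv hw h
      rw [Fin.lt_def] at h h1 h2
      exact (ih _ (by omega) hv hbW h1 rfl).trans (ih _ (by omega) hb hw h2 rfl)

/-- The graphs met in the reduction of `G(I, J̄)`: forests drawn without crossings whose edges join
a source to a later sink. Acyclicity is expressed by linear independence of the vectors
`e_w - e_v` for the edges `(v, w)`, tested against all functions `f` on the vertices. -/
structure IsNoncrossingForest (I J : Finset (Fin n)) (N : Finset (Fin n × Fin n)) : Prop where
  lt : ∀ {v w}, (v, w) ∈ N → v < w
  left_mem : ∀ {v w}, (v, w) ∈ N → v ∈ I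
  right_mem : ∀ {v w}, (v, w) ∈ N → w ∈ precSet I J
  noncrossing : ∀ {a b i k}, (a, b) ∈ N → (i, k) ∈ N → a < i → i < b → ¬ b < k
  acyclic : ∀ c : Fin n × Fin n → ℝ, (∀ f : Fin n → ℝ, ∑ e ∈ N, c e * (f e.2 - f e.1) = 0) →
    ∀ e ∈ N, c e = 0

namespace IsNoncrossingForest

variable {N : Finset (Fin n × Fin n)}

lemma subset (hN : IsNoncrossingForest I J N) {N' : Finset (Fin n × Fin n)} (h : N' ⊆ N) :
    IsNoncrossingForest I J N' where
  lt he := hN.lt (h he)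
  left_mem he := hN.left_mem (h he)
  right_mem he := hN.right_mem (h he)
  noncrossing h1 h2 := hN.noncrossing (h h1) (h h2)
  acyclic c hc e he := by
    have := hN.acyclic (fun e => if e ∈ N' then c e else 0) (fun f => by
      rw [← Finset.sum_subset h (fun e _ he => by rw [if_neg he, zero_mul]), ← hc f]
      exact Finset.sum_congr rfl fun e he => by rw [if_pos he]) e (h he)
    simpa [he] using this

/-- An acyclic graph with edges `(i, j)`, `(j, k)` does not contain the edge `(i, k)`. -/
lemma notMem_of_pair (hN : IsNoncrossingForest I J N) {i j k : Fin n} (h : NonAlternating N i j k) :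
    (i, k) ∉ N := by
  intro hik
  obtain ⟨h1, h2, hij, hjk⟩ := h
  have e1 : (i, k) ≠ (i, j) := by simp [h2.ne']
  have e2 : (i, k) ≠ (j, k) := by simp [h1.ne]
  have := hN.acyclic (fun e => (if e = (i, k) then 1 else 0) - (if e = (i, j) then 1 else 0)
    - (if e = (j, k) then 1 else 0)) (fun f => by
      simp only [sub_mul, ite_mul, one_mul, zero_mul, Finset.sum_sub_distrib, Finset.sum_ite_eq',
        hik, hij, hjk, if_true]
      ring) _ hik
  simp [e1, e2] at this

/-- Replacing the vector of the edge `q` by its sum with that of another edge `p` preserves linear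
independence. -/
lemma acyclic_exchange {N : Finset (Fin n × Fin n)} {p q r : Fin n × Fin n} (hp : p ∈ N)
    (hq : q ∈ N) (hr : r ∉ N) (hpq : p ≠ q)
    (h : ∀ f : Fin n → ℝ, f r.2 - f r.1 = (f p.2 - f p.1) + (f q.2 - f q.1))
    (hN : ∀ c : Fin n × Fin n → ℝ, (∀ f : Fin n → ℝ, ∑ e ∈ N, c e * (f e.2 - f e.1) = 0) →
      ∀ e ∈ N, c e = 0)
    (c : Fin n × Fin n → ℝ)
    (hc : ∀ f : Fin n → ℝ, ∑ e ∈ insert r (N.erase q), c e * (f e.2 - f e.1) = 0) :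
    ∀ e ∈ insert r (N.erase q), c e = 0 := by
  have hpN : p ∈ N.erase q := Finset.mem_erase.2 ⟨hpq, hp⟩
  have key := hN (fun e => if e = q then c r else if e = p then c p + c r else c e) (fun f => by
    rw [← hc f, Finset.sum_insert (fun hh => hr (Finset.mem_of_mem_erase hh)),
      ← Finset.add_sum_erase _ _ hq, ← Finset.add_sum_erase _ _ hpN,
      ← Finset.add_sum_erase _ _ hpN,
      Finset.sum_congr rfl (g := fun e => c e * (f e.2 - f e.1)) (fun e he => ?_)]
    · simp only [if_true, hpq, if_false]
      rw [h f]; ring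
    · have h1 := (Finset.mem_erase.1 he).1
      have h2 := (Finset.mem_erase.1 (Finset.mem_erase.1 he).2).1
      simp [h1, h2])
  have hr0 : c r = 0 := by simpa using key q hq
  intro e he
  rcases Finset.mem_insert.1 he with rfl | he
  · exact hr0
  · have h1 := key e (Finset.mem_of_mem_erase he)
    have h2 := (Finset.mem_erase.1 he).1
    by_cases h3 : e = p
    · subst h3; simpa [h2, hr0] using h1
    · simpa [h2, h3] using h1

lemma noncrossing_insert (hN : IsNoncrossingForest I J N) {i j k : Fin n}
    (h : LongestPair N i j k) {a b c d : Fin n} (h1 : (a, b) ∈ insert (i, k) N)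
    (h2 : (c, d) ∈ insert (i, k) N) (hac : a < c) (hcb : c < b) : ¬ b < d := by
  obtain ⟨⟨hij, hjk, eij, ejk⟩, hl, hr⟩ := h
  intro hbd
  simp only [Finset.mem_insert, Prod.mk.injEq] at h1 h2
  rcases h1 with ⟨rfl, rfl⟩ | h1 <;> rcases h2 with ⟨rfl, rfl⟩ | h2
  · exact lt_irrefl _ hac
  · rcases lt_trichotomy c j with h | rfl | h
    · exact hN.noncrossing eij h2 hac h (hjk.trans hbd)
    · exact hr ⟨d, hbd, h2⟩
    · exact hN.noncrossing ejk h2 h hcb hbd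
  · rcases lt_trichotomy b j with h | rfl | h
    · exact hN.noncrossing h1 eij hac hcb h
    · exact hl ⟨a, hac, h1⟩
    · exact hN.noncrossing h1 ejk (hac.trans hij) h hbd
  · exact hN.noncrossing h1 h2 hac hcb hbd

lemma exchange (hN : IsNoncrossingForest I J N) {i j k : Fin n} (h : LongestPair N i j k)
    {p q : Fin n × Fin n} (hpq : p = (i, j) ∧ q = (j, k) ∨ p = (j, k) ∧ q = (i, j)) :
    IsNoncrossingForest I J (insert (i, k) (N.erase q)) := by
  have hik := hN.notMem_of_pair h.1
  have hsub : insert (i, k) (N.erase q) ⊆ insert (i, k) N :=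
    Finset.insert_subset_insert _ (Finset.erase_subset _ _)
  obtain ⟨hij, hjk, eij, ejk⟩ := h.1
  refine ⟨fun he => ?_, fun he => ?_, fun he => ?_, fun h1 h2 =>
    hN.noncrossing_insert h (hsub h1) (hsub h2), ?_⟩
  · rcases Finset.mem_insert.1 (hsub he) with e | he
    · cases e; exact hij.trans hjk
    · exact hN.lt he
  · rcases Finset.mem_insert.1 (hsub he) with e | he
    · cases e; exact hN.left_mem eij
    · exact hN.left_mem he
  · rcases Finset.mem_insert.1 (hsub he) with e | he
    · cases e; exact hN.right_mem ejk
    · exact hN.right_mem he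
  · rcases hpq with ⟨rfl, rfl⟩ | ⟨rfl, rfl⟩
    · exact acyclic_exchange eij ejk hik (by simp [hij.ne]) (fun f => by ring) hN.acyclic
    · exact acyclic_exchange ejk eij hik (by simp [hij.ne']) (fun f => by ring) hN.acyclic

lemma reach_lt (hN : IsNoncrossingForest I J N) {a b : Fin n} (h : Reach N a b) : a < b := by
  induction h with
  | single h => exact hN.lt h
  | tail _ h ih => exact ih.trans (hN.lt h)

/-- A path that starts before the source of an edge `(i, j)` and ends strictly between `i` and `j`
passes through `i`. -/
lemma reach_of_lt (hN : IsNoncrossingForest I J N) {i j a b : Fin n} (hij : (i, j) ∈ N)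
    (h : Reach N a b) (ha : a < i) (hib : i ≤ b) (hbj : b < j) : Reach N a i := by
  induction h with
  | @single b h =>
    rcases hib.eq_or_lt with rfl | hib
    · exact Relation.TransGen.single h
    · exact absurd hbj (hN.noncrossing h hij ha hib)
  | @tail b c hab hbc ih =>
    rcases le_or_gt i b with h | h
    · exact ih h ((hN.lt hbc).trans hbj)
    · rcases hib.eq_or_lt with rfl | hib
      · exact Relation.TransGen.tail hab hbc
      · exact absurd hbj (hN.noncrossing hbc hij h hib)

lemma reach_of_gt (hN : IsNoncrossingForest I J N) {j k a b : Fin n} (hjk : (j, k) ∈ N)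
    (h : Reach N a b) (hja : j < a) (hak : a ≤ k) (hkb : k < b) : Reach N k b := by
  induction h using Relation.TransGen.head_induction_on with
  | @single a h =>
    rcases hak.eq_or_lt with rfl | hak
    · exact Relation.TransGen.single h
    · exact absurd hkb (hN.noncrossing hjk h hja hak)
  | @head a c hac hcb ih =>
    rcases le_or_gt c k with h | h
    · exact ih (hja.trans (hN.lt hac)) h
    · rcases hak.eq_or_lt with rfl | hak
      · exact Relation.TransGen.head hac hcb
      · exact absurd h (hN.noncrossing hjk hac hja hak)

/-- A path which is lost when `(j, k)` is exchanged for `(i, k)` uses `(j, k)`, and either starts at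
`j` or enters `j` by a shorter edge than `(i, j)`; as nothing crosses `(i, j)`, it starts
after `i`. -/
lemma reach_exchange_right (hN : IsNoncrossingForest I J N) {i j k a b : Fin n}
    (h : LongestPair N i j k) (hab : Reach N a b) :
    Reach (insert (i, k) (N.erase (j, k))) a b ∨ (i < a ∧ a ≤ j ∧ k ≤ b) := by
  have hN' := hN.exchange h (Or.inl ⟨rfl, rfl⟩)
  obtain ⟨⟨hij, hjk, eij, ejk⟩, hl, hr⟩ := h
  set N' := insert (i, k) (N.erase (j, k)) with hN'def
  have hik' : (i, k) ∈ N' := Finset.mem_insert_self _ _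
  have hmem : ∀ {e}, e ∈ N → e ≠ (j, k) → e ∈ N' := fun he hne =>
    Finset.mem_insert_of_mem (Finset.mem_erase.2 ⟨hne, he⟩)
  have hij' : (i, j) ∈ N' := hmem eij (by simp [hij.ne])
  have hlast : ∀ {u}, (u, j) ∈ N' → i ≤ u := by
    intro u hu
    rcases Finset.mem_insert.1 hu with e | hu
    · cases e; exact le_rfl
    · by_contra hc
      exact hl ⟨u, not_le.1 hc, Finset.mem_of_mem_erase hu⟩
  induction hab with
  | @single b hab =>
    by_cases he : (a, b) = (j, k)
    · cases he; exact Or.inr ⟨hij, le_rfl, le_rfl⟩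
    · exact Or.inl (Relation.TransGen.single (hmem hab he))
  | @tail b c hab hbc ih =>
    rcases ih with ih | ih
    swap
    · exact Or.inr ⟨ih.1, ih.2.1, ih.2.2.trans (hN.lt hbc).le⟩
    by_cases he : (b, c) = (j, k)
    swap
    · exact Or.inl (ih.tail (hmem hbc he))
    cases he
    obtain ⟨u, hau, huj⟩ := Relation.TransGen.tail'_iff.1 ih
    have haj := hN'.reach_lt ih
    rcases lt_trichotomy a i with hai | rfl | hai
    · left
      refine Relation.TransGen.tail ?_ hik'
      rcases Relation.reflTransGen_iff_eq_or_transGen.1 hau with rfl | hau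
      · exact absurd hai (not_lt.2 (hlast huj))
      · exact hN'.reach_of_lt hij' hau hai (hlast huj) (hN'.lt huj)
    · exact Or.inl (Relation.TransGen.single hik')
    · exact Or.inr ⟨hai, haj.le, le_rfl⟩

/-- The mirror image of `reach_exchange_right`: a path which is lost when `(i, j)` is exchanged for
`(i, k)` ends before `k`. -/
lemma reach_exchange_left (hN : IsNoncrossingForest I J N) {i j k a b : Fin n}
    (h : LongestPair N i j k) (hab : Reach N a b) :
    Reach (insert (i, k) (N.erase (i, j))) a b ∨ (a ≤ i ∧ j ≤ b ∧ b < k) := by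
  have hN' := hN.exchange h (Or.inr ⟨rfl, rfl⟩)
  obtain ⟨⟨hij, hjk, eij, ejk⟩, hl, hr⟩ := h
  set N' := insert (i, k) (N.erase (i, j)) with hN'def
  have hik' : (i, k) ∈ N' := Finset.mem_insert_self _ _
  have hmem : ∀ {e}, e ∈ N → e ≠ (i, j) → e ∈ N' := fun he hne =>
    Finset.mem_insert_of_mem (Finset.mem_erase.2 ⟨hne, he⟩)
  have hjk' : (j, k) ∈ N' := hmem ejk (by simp [hij.ne'])
  have hfirst : ∀ {u}, (j, u) ∈ N' → u ≤ k := by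
    intro u hu
    rcases Finset.mem_insert.1 hu with e | hu
    · cases e; exact le_rfl
    · by_contra hc
      exact hr ⟨u, not_le.1 hc, Finset.mem_of_mem_erase hu⟩
  induction hab using Relation.TransGen.head_induction_on with
  | @single a hab =>
    by_cases he : (a, b) = (i, j)
    · cases he; exact Or.inr ⟨le_rfl, le_rfl, hjk⟩
    · exact Or.inl (Relation.TransGen.single (hmem hab he))
  | @head a c hac hcb ih =>
    rcases ih with ih | ih
    swap
    · exact Or.inr ⟨(hN.lt hac).le.trans ih.1, ih.2⟩
    by_cases he : (a, c) = (i, j)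
    swap
    · exact Or.inl (Relation.TransGen.head (hmem hac he) ih)
    cases he
    obtain ⟨u, hju, hub⟩ := Relation.TransGen.head'_iff.1 ih
    have hjb := hN'.reach_lt ih
    rcases lt_trichotomy b k with hbk | rfl | hbk
    · exact Or.inr ⟨le_rfl, hjb.le, hbk⟩
    · exact Or.inl (Relation.TransGen.single hik')
    · left
      refine Relation.TransGen.head hik' ?_
      rcases Relation.reflTransGen_iff_eq_or_transGen.1 hub with rfl | hub
      · exact absurd hbk (not_lt.2 (hfirst hju))
      · exact hN'.reach_of_gt hjk' hub (hN'.lt hju) (hfirst hju) hbk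

/-- The combinatorial heart of the argument: a path lost in the first exchange and a path lost in
the second one stand for crossing arcs, so a noncrossing set of arcs survives in one of the two. -/
lemma reach_exchange (hN : IsNoncrossingForest I J N) {i j k : Fin n}
    (h : LongestPair N i j k) {F : Set (Fin n × Fin n)} (hF : ∀ e ∈ F, Reach N e.1 e.2)
    (hnc : ∀ e ∈ F, ∀ e' ∈ F, e.1 < e'.1 → e'.1 ≤ e.2 → ¬ e.2 < e'.2) :
    (∀ e ∈ F, Reach (insert (i, k) (N.erase (j, k))) e.1 e.2) ∨
      (∀ e ∈ F, Reach (insert (i, k) (N.erase (i, j))) e.1 e.2) := by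
  by_contra! hc
  obtain ⟨⟨e, he, h1⟩, ⟨e', he', h2⟩⟩ := hc
  have h3 := (hN.reach_exchange_right h (hF e he)).resolve_left h1
  have h4 := (hN.reach_exchange_left h (hF e' he')).resolve_left h2
  exact hnc e' he' e he (h4.1.trans_lt h3.1) (h3.2.1.trans h4.2.1) (h4.2.2.trans_le h3.2.2)

lemma mem_of_reach (halt : ∀ i j k, ¬ NonAlternating N i j k) (hN : IsNoncrossingForest I J N)
    {a b : Fin n} (h : Reach N a b) : (a, b) ∈ N := by
  induction h with
  | single h => exact h
  | tail _ h ih => exact absurd ⟨hN.lt ih, hN.lt h, ih, h⟩ (halt _ _ _)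

end IsNoncrossingForest

/-- A flow on `G(I, J̄)` without sources and sinks vanishes. -/
lemma graphG_acyclic (I J : Finset (Fin n)) (c : Fin n × Fin n → ℝ)
    (hc : ∀ f : Fin n → ℝ, ∑ e ∈ graphG I J, c e * (f e.2 - f e.1) = 0) :
    ∀ e ∈ graphG I J, c e = 0 := by
  -- by induction from left to right: the edges out of `v` carry no flow in total, since those into
  -- `v` carry none, and all but one of them end at a vertex with no other edge
  suffices H : ∀ v w, (v, w) ∈ graphG I J → c (v, w) = 0 from fun e he => H _ _ he
  intro v
  induction v using WellFoundedLT.induction with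
  | _ v ih =>
  have hsink : ∀ w, (v, w) ∈ graphG I J → w ∉ I → c (v, w) = 0 := by
    intro w hvw hw
    have h1 := hc (fun u => if u = w then 1 else 0)
    rw [Finset.sum_eq_single_of_mem (v, w) hvw] at h1
    · simpa [(mem_graphG.1 hvw).2.2.1.ne] using h1
    · rintro ⟨a, b⟩ hab hne
      have ha : a ≠ w := fun e => hw (e ▸ (mem_graphG.1 hab).1)
      have hb : b ≠ w := by
        rintro rfl
        have hav : a ≠ v := fun e => hne (by rw [e])
        obtain ⟨hv, hb, hvb, h3⟩ := mem_graphG.1 hvw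
        obtain ⟨ha, -, hab, h4⟩ := mem_graphG.1 hab
        rcases lt_or_gt_of_ne hav with h | h
        · obtain ⟨x, hx, hxW, h5, h6⟩ := exists_mem_inter_of_lt hv hb hw hvb
          exact h4 x hx hxW (h.trans_le h5) h6
        · obtain ⟨x, hx, hxW, h5, h6⟩ := exists_mem_inter_of_lt ha hb hw hab
          exact h3 x hx hxW (h.trans_le h5) h6
      simp [ha, hb]
  intro w hvw
  by_cases hw : w ∈ I
  swap
  · exact hsink w hvw hw
  have h1 := hc (fun u => if u = v then 1 else 0)
  rw [Finset.sum_eq_single_of_mem (v, w) hvw] at h1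
  · simpa [(mem_graphG.1 hvw).2.2.1.ne'] using h1
  · rintro ⟨a, b⟩ hab hne
    by_cases hb : b = v
    · subst hb
      rw [ih a (mem_graphG.1 hab).2.2.1 b hab, zero_mul]
    by_cases ha : a = v
    · subst ha
      rw [hsink b hab, zero_mul]
      intro hbI
      obtain ⟨-, hwW, h3, h4⟩ := mem_graphG.1 hvw
      obtain ⟨-, hbW, h5, h6⟩ := mem_graphG.1 hab
      have hbw : b ≠ w := fun e => hne (by rw [e])
      rcases lt_or_gt_of_ne hbw with h | h
      · exact h4 b hbI hbW h5 h
      · exact h6 w hw hwW h3 h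
    · simp [ha, hb]

lemma isNoncrossingForest_graphG (I J : Finset (Fin n)) :
    IsNoncrossingForest I J (graphG I J) where
  lt h := (mem_graphG.1 h).2.2.1
  left_mem h := (mem_graphG.1 h).1
  right_mem h := (mem_graphG.1 h).2.1
  noncrossing {a b i k} h1 h2 hai hib hbk := by
    obtain ⟨-, hb, hab, h3⟩ := mem_graphG.1 h1
    obtain ⟨hi, -, hik, h4⟩ := mem_graphG.1 h2
    by_cases hiW : i ∈ precSet I J
    · exact h3 i hi hiW hai hib
    · obtain ⟨x, hx, hxW, h5, h6⟩ := exists_mem_inter_of_lt' hi hb hiW hib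
      exact h4 x hx hxW h5 (h6.trans_lt hbk)
  acyclic := graphG_acyclic I J

/-! ### Supports under reductions -/

/-- All integer coefficients are nonnegative, so that no cancellation occurs. -/
def NonnegCoeffs (p : SubdivPoly n) : Prop := ∀ m t, 0 ≤ (p.coeff m).coeff t

lemma NonnegCoeffs.add {p q : SubdivPoly n} (hp : NonnegCoeffs p) (hq : NonnegCoeffs q) :
    NonnegCoeffs (p + q) := fun m t => by
  rw [MvPolynomial.coeff_add, Polynomial.coeff_add]; exact add_nonneg (hp m t) (hq m t)

lemma NonnegCoeffs.monomial (m : (Fin n × Fin n) →₀ ℕ) {c : Polynomial ℤ}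
    (hc : ∀ t, 0 ≤ c.coeff t) : NonnegCoeffs (MvPolynomial.monomial m c) := fun m' t => by
  classical
  rw [MvPolynomial.coeff_monomial]
  split_ifs
  · exact hc t
  · simp

lemma NonnegCoeffs.sum {ι : Type*} {s : Finset ι} {f : ι → SubdivPoly n}
    (h : ∀ i ∈ s, NonnegCoeffs (f i)) : NonnegCoeffs (∑ i ∈ s, f i) := fun m t => by
  rw [MvPolynomial.coeff_sum, Polynomial.finsetSum_coeff]
  exact Finset.sum_nonneg fun i hi => h i hi m t

lemma NonnegCoeffs.mem_support_sum {ι : Type*} {s : Finset ι} {f : ι → SubdivPoly n}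
    (h : ∀ i ∈ s, NonnegCoeffs (f i)) {i : ι} (hi : i ∈ s) {m : (Fin n × Fin n) →₀ ℕ}
    (hm : m ∈ (f i).support) : m ∈ (∑ i ∈ s, f i).support := by
  rw [MvPolynomial.mem_support_iff] at hm ⊢
  intro h0
  apply hm
  ext t
  have h1 : ∑ i ∈ s, ((f i).coeff m).coeff t = 0 := by
    rw [← Polynomial.finsetSum_coeff, ← MvPolynomial.coeff_sum, h0, Polynomial.coeff_zero]
  simpa using (Finset.sum_eq_zero_iff_of_nonneg fun i hi => h i hi m t).1 h1 i hi

lemma NonnegCoeffs.mem_support_add_left {p q : SubdivPoly n} (hp : NonnegCoeffs p)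
    (hq : NonnegCoeffs q) {m : (Fin n × Fin n) →₀ ℕ} (hm : m ∈ p.support) :
    m ∈ (p + q).support := by
  rw [MvPolynomial.mem_support_iff] at hm ⊢
  intro h0
  apply hm
  ext t
  have h1 := congrArg (fun c => Polynomial.coeff c t) h0
  simp only [MvPolynomial.coeff_add, Polynomial.coeff_add, Polynomial.coeff_zero] at h1 ⊢
  exact le_antisymm (by linarith [hq m t]) (hp m t)

/-- The exponent vector after exchanging `x_{jk}` for `x_{ik}` in `x_{ij} x_{jk}`. -/
def expRight (i j k : Fin n) (m : (Fin n × Fin n) →₀ ℕ) : (Fin n × Fin n) →₀ ℕ :=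
  m - pairExp i j k + (Finsupp.single (i, k) 1 + Finsupp.single (i, j) 1)

/-- The exponent vector after exchanging `x_{ij}` for `x_{ik}` in `x_{ij} x_{jk}`. -/
def expLeft (i j k : Fin n) (m : (Fin n × Fin n) →₀ ℕ) : (Fin n × Fin n) →₀ ℕ :=
  m - pairExp i j k + (Finsupp.single (j, k) 1 + Finsupp.single (i, k) 1)

/-- The exponent vector after replacing `x_{ij} x_{jk}` by `x_{ik}`. -/
def expBoth (i j k : Fin n) (m : (Fin n × Fin n) →₀ ℕ) : (Fin n × Fin n) →₀ ℕ :=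
  m - pairExp i j k + Finsupp.single (i, k) 1

open Classical in
/-- What becomes of the term `c x^m` in a reduction. -/
def reducedTerm (i j k : Fin n) (m : (Fin n × Fin n) →₀ ℕ) (c : Polynomial ℤ) : SubdivPoly n :=
  if pairExp i j k ≤ m then
    MvPolynomial.monomial (expRight i j k m) c + MvPolynomial.monomial (expLeft i j k m) c +
      MvPolynomial.monomial (expBoth i j k m) (c * Polynomial.X)
  else MvPolynomial.monomial m c

lemma reduceAt_eq (i j k : Fin n) (p : SubdivPoly n) :
    reduceAt i j k p = ∑ m ∈ p.support, reducedTerm i j k m (p.coeff m) := by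
  unfold reduceAt reducedTerm
  refine Finset.sum_congr rfl fun m _ => ?_
  split_ifs with h
  · simp only [mul_add, beta, MvPolynomial.X, MvPolynomial.C_apply, MvPolynomial.monomial_mul,
      expRight, expLeft, expBoth, mul_one, zero_add]
  · rfl

lemma NonnegCoeffs.coeff_mul_X {c : Polynomial ℤ} (hc : ∀ t, 0 ≤ c.coeff t) (t : ℕ) :
    0 ≤ (c * Polynomial.X).coeff t := by
  cases t with
  | zero => simp
  | succ t => rw [Polynomial.coeff_mul_X]; exact hc t

lemma NonnegCoeffs.reducedTerm (i j k : Fin n) (m : (Fin n × Fin n) →₀ ℕ) {c : Polynomial ℤ}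
    (hc : ∀ t, 0 ≤ c.coeff t) : NonnegCoeffs (reducedTerm i j k m c) := by
  unfold IJTamari.reducedTerm
  split_ifs
  · exact ((NonnegCoeffs.monomial _ hc).add (NonnegCoeffs.monomial _ hc)).add
      (NonnegCoeffs.monomial _ (NonnegCoeffs.coeff_mul_X hc))
  · exact NonnegCoeffs.monomial _ hc

lemma NonnegCoeffs.reduceAt (i j k : Fin n) {p : SubdivPoly n} (hp : NonnegCoeffs p) :
    NonnegCoeffs (reduceAt i j k p) := by
  rw [reduceAt_eq]
  exact NonnegCoeffs.sum fun m _ => NonnegCoeffs.reducedTerm i j k m (hp m)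

lemma mem_support_reduceAt {i j k : Fin n} {p : SubdivPoly n} {m' : (Fin n × Fin n) →₀ ℕ}
    (h : m' ∈ (reduceAt i j k p).support) :
    (m' ∈ p.support ∧ ¬ pairExp i j k ≤ m') ∨ ∃ m ∈ p.support, pairExp i j k ≤ m ∧
      (m' = expRight i j k m ∨ m' = expLeft i j k m ∨ m' = expBoth i j k m) := by
  classical
  rw [reduceAt_eq, MvPolynomial.mem_support_iff, MvPolynomial.coeff_sum] at h
  obtain ⟨m, hm, hne⟩ := Finset.exists_ne_zero_of_sum_ne_zero h
  unfold reducedTerm at hne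
  split_ifs at hne with hle
  · right
    refine ⟨m, hm, hle, ?_⟩
    by_contra! hc
    apply hne
    simp [MvPolynomial.coeff_add, MvPolynomial.coeff_monomial, hc.1.symm, hc.2.1.symm,
      hc.2.2.symm]
  · left
    rw [MvPolynomial.coeff_monomial] at hne
    have : m = m' := by
      by_contra hc; exact hne (if_neg hc)
    subst this
    exact ⟨hm, hle⟩

lemma mem_support_reduceAt_of_not_le {i j k : Fin n} {p : SubdivPoly n} (hp : NonnegCoeffs p)
    {m : (Fin n × Fin n) →₀ ℕ} (hm : m ∈ p.support) (h : ¬ pairExp i j k ≤ m) :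
    m ∈ (reduceAt i j k p).support := by
  classical
  rw [reduceAt_eq]
  refine NonnegCoeffs.mem_support_sum (fun m _ => NonnegCoeffs.reducedTerm i j k m (hp m)) hm ?_
  rw [reducedTerm, if_neg h, MvPolynomial.mem_support_iff, MvPolynomial.coeff_monomial, if_pos rfl]
  exact MvPolynomial.mem_support_iff.1 hm

lemma mem_support_reduceAt_of_le {i j k : Fin n} {p : SubdivPoly n} (hp : NonnegCoeffs p)
    {m : (Fin n × Fin n) →₀ ℕ} (hm : m ∈ p.support) (h : pairExp i j k ≤ m) :
    expRight i j k m ∈ (reduceAt i j k p).support ∧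
      expLeft i j k m ∈ (reduceAt i j k p).support := by
  classical
  have h1 : ∀ m', m' ∈ (MvPolynomial.monomial m' (p.coeff m) : SubdivPoly n).support := fun m' => by
    rw [MvPolynomial.mem_support_iff, MvPolynomial.coeff_monomial, if_pos rfl]
    exact MvPolynomial.mem_support_iff.1 hm
  have h2 : ∀ m', NonnegCoeffs (MvPolynomial.monomial m' (p.coeff m) : SubdivPoly n) := fun m' =>
    NonnegCoeffs.monomial m' (hp m)
  have h3 : ∀ m', NonnegCoeffs (MvPolynomial.monomial m' (p.coeff m * Polynomial.X) :
      SubdivPoly n) := fun m' => NonnegCoeffs.monomial m' (NonnegCoeffs.coeff_mul_X (hp m))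
  rw [reduceAt_eq]
  constructor <;>
  refine NonnegCoeffs.mem_support_sum (fun m _ => NonnegCoeffs.reducedTerm i j k m (hp m)) hm ?_ <;>
  rw [reducedTerm, if_pos h] <;>
  refine NonnegCoeffs.mem_support_add_left ((h2 _).add (h2 _)) (h3 _) ?_
  · exact NonnegCoeffs.mem_support_add_left (h2 _) (h2 _) (h1 _)
  · rw [add_comm]
    exact NonnegCoeffs.mem_support_add_left (h2 _) (h2 _) (h1 _)

lemma pairExp_le_iff {i j k : Fin n} (hij : i < j) (hjk : j < k) {m : (Fin n × Fin n) →₀ ℕ} :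
    pairExp i j k ≤ m ↔ NonAlternating (graphOf m) i j k := by
  have hne : (i, j) ≠ (j, k) := by simp [hij.ne]
  simp only [NonAlternating, graphOf, Finsupp.mem_support_iff, hij, hjk, true_and]
  constructor
  · intro h
    have h1 := h (i, j)
    have h2 := h (j, k)
    simp [pairExp, hij.ne, hij.ne'] at h1 h2
    omega
  · rintro ⟨h1, h2⟩ e
    simp only [pairExp, Finsupp.add_apply, Finsupp.single_apply]
    by_cases e1 : (i, j) = e
    · subst e1
      rw [if_pos rfl, if_neg hne.symm]; omega
    · rw [if_neg e1]
      by_cases e2 : (j, k) = e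
      · subst e2
        rw [if_pos rfl]; omega
      · rw [if_neg e2]; omega

section Exponents

variable {i j k : Fin n} {m : (Fin n × Fin n) →₀ ℕ}

lemma expRight_apply (hm : ∀ e, m e ≤ 1) (h : NonAlternating (graphOf m) i j k)
    (hik : (i, k) ∉ graphOf m) (e : Fin n × Fin n) :
    expRight i j k m e = if e = (i, k) then 1 else if e = (j, k) then 0 else m e := by
  obtain ⟨hij, hjk, h1, h2⟩ := h
  simp only [graphOf, Finsupp.mem_support_iff, not_not] at h1 h2 hik
  have := hm (i, j)
  have := hm (j, k)
  simp only [expRight, pairExp, Finsupp.add_apply, Finsupp.tsub_apply, Finsupp.single_apply]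
  have a1 : (i, j) ≠ (j, k) := by simp [hij.ne]
  have a2 : (i, k) ≠ (i, j) := by simp [hjk.ne']
  have a3 : (i, k) ≠ (j, k) := by simp [hij.ne]
  grind

lemma expLeft_apply (hm : ∀ e, m e ≤ 1) (h : NonAlternating (graphOf m) i j k)
    (hik : (i, k) ∉ graphOf m) (e : Fin n × Fin n) :
    expLeft i j k m e = if e = (i, k) then 1 else if e = (i, j) then 0 else m e := by
  obtain ⟨hij, hjk, h1, h2⟩ := h
  simp only [graphOf, Finsupp.mem_support_iff, not_not] at h1 h2 hik
  have := hm (i, j)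
  have := hm (j, k)
  simp only [expLeft, pairExp, Finsupp.add_apply, Finsupp.tsub_apply, Finsupp.single_apply]
  have a1 : (i, j) ≠ (j, k) := by simp [hij.ne]
  have a2 : (i, k) ≠ (i, j) := by simp [hjk.ne']
  have a3 : (i, k) ≠ (j, k) := by simp [hij.ne]
  grind

lemma expBoth_apply (hm : ∀ e, m e ≤ 1) (h : NonAlternating (graphOf m) i j k)
    (hik : (i, k) ∉ graphOf m) (e : Fin n × Fin n) :
    expBoth i j k m e =
      if e = (i, k) then 1 else if e = (i, j) ∨ e = (j, k) then 0 else m e := by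
  obtain ⟨hij, hjk, h1, h2⟩ := h
  simp only [graphOf, Finsupp.mem_support_iff, not_not] at h1 h2 hik
  have := hm (i, j)
  have := hm (j, k)
  simp only [expBoth, pairExp, Finsupp.add_apply, Finsupp.tsub_apply, Finsupp.single_apply]
  have a1 : (i, j) ≠ (j, k) := by simp [hij.ne]
  have a2 : (i, k) ≠ (i, j) := by simp [hjk.ne']
  have a3 : (i, k) ≠ (j, k) := by simp [hij.ne]
  grind

lemma graphOf_expRight (hm : ∀ e, m e ≤ 1) (h : NonAlternating (graphOf m) i j k)
    (hik : (i, k) ∉ graphOf m) :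
    graphOf (expRight i j k m) = insert (i, k) ((graphOf m).erase (j, k)) := by
  ext e
  rw [graphOf, Finsupp.mem_support_iff, expRight_apply hm h hik, Finset.mem_insert,
    Finset.mem_erase, graphOf, Finsupp.mem_support_iff]
  grind

lemma graphOf_expLeft (hm : ∀ e, m e ≤ 1) (h : NonAlternating (graphOf m) i j k)
    (hik : (i, k) ∉ graphOf m) :
    graphOf (expLeft i j k m) = insert (i, k) ((graphOf m).erase (i, j)) := by
  ext e
  rw [graphOf, Finsupp.mem_support_iff, expLeft_apply hm h hik, Finset.mem_insert,
    Finset.mem_erase, graphOf, Finsupp.mem_support_iff]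
  grind

lemma graphOf_expBoth_subset (hm : ∀ e, m e ≤ 1) (h : NonAlternating (graphOf m) i j k)
    (hik : (i, k) ∉ graphOf m) :
    graphOf (expBoth i j k m) ⊆ insert (i, k) ((graphOf m).erase (j, k)) := by
  intro e
  rw [graphOf, Finsupp.mem_support_iff, expBoth_apply hm h hik, Finset.mem_insert,
    Finset.mem_erase, graphOf, Finsupp.mem_support_iff]
  grind

lemma degree_eq_card (hm : ∀ e, m e ≤ 1) : m.degree = (graphOf m).card := by
  rw [Finsupp.degree_apply, graphOf, Finset.card_eq_sum_ones]
  refine Finset.sum_congr rfl fun e he => ?_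
  have := hm e
  have := Finsupp.mem_support_iff.1 he
  omega

lemma card_exchange {V : Type*} [DecidableEq V] {N : Finset V} {q r : V} (hq : q ∈ N)
    (hr : r ∉ N) : (insert r (N.erase q)).card = N.card := by
  rw [Finset.card_insert_of_notMem (fun h => hr (Finset.mem_of_mem_erase h)),
    Finset.card_erase_add_one hq]

end Exponents

/-! ### Partial reductions -/

/-- The arcs of `F` (recorded as source-sink pairs) are pairwise noncrossing. -/
def PairwiseNoncrossing (F : Set (Fin n × Fin n)) : Prop :=
  ∀ e ∈ F, ∀ e' ∈ F, e.1 < e'.1 → e'.1 ≤ e.2 → ¬ e.2 < e'.2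

/-- The properties of `M_G` preserved by reductions of longest pairs. The last one is the
combinatorial form of the statement that the polytopes of the graphs of highest degree cover
the flow polytope. -/
structure IsPartialReduction (I J : Finset (Fin n)) (p : SubdivPoly n) : Prop where
  nonneg : NonnegCoeffs p
  squarefree : ∀ m ∈ p.support, ∀ e, m e ≤ 1
  forest : ∀ m ∈ p.support, IsNoncrossingForest I J (graphOf m)
  card_le : ∀ m ∈ p.support, (graphOf m).card ≤ (graphG I J).card
  cover : ∀ F : Set (Fin n × Fin n), (∀ e ∈ F, e.1 ∈ I ∧ e.2 ∈ precSet I J ∧ e.1 < e.2) →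
    PairwiseNoncrossing F → ∃ m ∈ p.support, (graphOf m).card = (graphG I J).card ∧
      ∀ e ∈ F, Reach (graphOf m) e.1 e.2

lemma monomialG_eq (I J : Finset (Fin n)) : monomialG I J =
    MvPolynomial.monomial (∑ e ∈ graphG I J, Finsupp.single e 1) 1 := by
  rw [MvPolynomial.monomial_sum_one]; rfl

lemma sum_single_apply (N : Finset (Fin n × Fin n)) (e : Fin n × Fin n) :
    (∑ e ∈ N, Finsupp.single e 1 : (Fin n × Fin n) →₀ ℕ) e = if e ∈ N then 1 else 0 := by
  simp [Finsupp.finsetSum_apply, Finsupp.single_apply]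

lemma graphOf_sum_single (N : Finset (Fin n × Fin n)) :
    graphOf (∑ e ∈ N, Finsupp.single e 1) = N := by
  ext e
  rw [graphOf, Finsupp.mem_support_iff, sum_single_apply]
  simp

lemma isPartialReduction_monomialG (I J : Finset (Fin n)) :
    IsPartialReduction I J (monomialG I J) := by
  classical
  have hsupp : (monomialG I J).support = {∑ e ∈ graphG I J, Finsupp.single e 1} := by
    rw [monomialG_eq, MvPolynomial.support_monomial, if_neg one_ne_zero]
  refine ⟨?_, ?_, ?_, ?_, ?_⟩
  · rw [monomialG_eq]
    refine NonnegCoeffs.monomial _ fun t => ?_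
    rw [Polynomial.coeff_one]; split_ifs <;> simp
  · intro m hm e
    rw [hsupp, Finset.mem_singleton] at hm
    rw [hm, sum_single_apply]; split_ifs <;> simp
  · intro m hm
    rw [hsupp, Finset.mem_singleton] at hm
    rw [hm, graphOf_sum_single]; exact isNoncrossingForest_graphG I J
  · intro m hm
    rw [hsupp, Finset.mem_singleton] at hm
    rw [hm, graphOf_sum_single]
  · intro F hF _
    refine ⟨∑ e ∈ graphG I J, Finsupp.single e 1, by rw [hsupp, Finset.mem_singleton], ?_, ?_⟩
    · rw [graphOf_sum_single]
    · intro e he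
      rw [graphOf_sum_single]
      exact reach_graphG (hF e he).1 (hF e he).2.1 (hF e he).2.2

lemma IsPartialReduction.step {I J : Finset (Fin n)} {p q : SubdivPoly n}
    (hp : IsPartialReduction I J p) (h : LongestPairStep p q) : IsPartialReduction I J q := by
  obtain ⟨i, j, k, ⟨m₀, -, hij, hjk, -⟩, hlong, rfl⟩ := h
  have hle : ∀ {m : (Fin n × Fin n) →₀ ℕ}, pairExp i j k ≤ m ↔ NonAlternating (graphOf m) i j k :=
    pairExp_le_iff hij hjk
  have key : ∀ m' ∈ (reduceAt i j k p).support, (∀ e, m' e ≤ 1) ∧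
      IsNoncrossingForest I J (graphOf m') ∧ (graphOf m').card ≤ (graphG I J).card := by
    intro m' hm'
    rcases mem_support_reduceAt hm' with ⟨h1, -⟩ | ⟨m, hm, h1, h2⟩
    · exact ⟨hp.squarefree m' h1, hp.forest m' h1, hp.card_le m' h1⟩
    have hna := hle.1 h1
    have hsq := hp.squarefree m hm
    have hik := (hp.forest m hm).notMem_of_pair hna
    have hc := hp.card_le m hm
    have hright := (hp.forest m hm).exchange (hlong m hm hna) (Or.inl ⟨rfl, rfl⟩)
    rcases h2 with rfl | rfl | rfl
    · refine ⟨fun e => ?_, ?_, ?_⟩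
      · have := hsq e
        rw [expRight_apply hsq hna hik]; split_ifs <;> omega
      · rw [graphOf_expRight hsq hna hik]; exact hright
      · rwa [graphOf_expRight hsq hna hik, card_exchange hna.2.2.2 hik]
    · refine ⟨fun e => ?_, ?_, ?_⟩
      · have := hsq e
        rw [expLeft_apply hsq hna hik]; split_ifs <;> omega
      · rw [graphOf_expLeft hsq hna hik]
        exact (hp.forest m hm).exchange (hlong m hm hna) (Or.inr ⟨rfl, rfl⟩)
      · rwa [graphOf_expLeft hsq hna hik, card_exchange hna.2.2.1 hik]
    · have hsub := graphOf_expBoth_subset hsq hna hik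
      refine ⟨fun e => ?_, hright.subset hsub, (Finset.card_le_card hsub).trans ?_⟩
      · have := hsq e
        rw [expBoth_apply hsq hna hik]; split_ifs <;> omega
      · rwa [card_exchange hna.2.2.2 hik]
  refine ⟨hp.nonneg.reduceAt i j k, fun m hm => (key m hm).1, fun m hm => (key m hm).2.1,
    fun m hm => (key m hm).2.2, ?_⟩
  intro F hF hnc
  obtain ⟨m, hm, hcard, hreach⟩ := hp.cover F hF hnc
  by_cases h1 : pairExp i j k ≤ m
  · have hna := hle.1 h1
    have hsq := hp.squarefree m hm
    have hik := (hp.forest m hm).notMem_of_pair hna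
    obtain ⟨h3, h4⟩ := mem_support_reduceAt_of_le hp.nonneg hm h1
    rcases (hp.forest m hm).reach_exchange (hlong m hm hna) hreach hnc with h | h
    · refine ⟨_, h3, ?_, ?_⟩
      · rwa [graphOf_expRight hsq hna hik, card_exchange hna.2.2.2 hik]
      · rwa [graphOf_expRight hsq hna hik]
    · refine ⟨_, h4, ?_, ?_⟩
      · rwa [graphOf_expLeft hsq hna hik, card_exchange hna.2.2.1 hik]
      · rwa [graphOf_expLeft hsq hna hik]
  · exact ⟨m, mem_support_reduceAt_of_not_le hp.nonneg hm h1, hcard, hreach⟩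

lemma LengthOrderStep.longestPairStep {p q : SubdivPoly n} (h : LengthOrderStep p q) :
    LongestPairStep p q := by
  obtain ⟨i, j, k, h1, h2, h3⟩ := h
  exact ⟨i, j, k, h1, fun m hm hna => (h2 m hm hna).1, h3⟩

lemma IsLengthReducedForm.isLongestPairReducedForm {I J : Finset (Fin n)} {p : SubdivPoly n}
    (h : IsLengthReducedForm I J p) : IsLongestPairReducedForm I J p :=
  ⟨Relation.ReflTransGen.mono (fun _ _ => LengthOrderStep.longestPairStep) _ _ h.1, h.2⟩

lemma IsLongestPairReducedForm.isPartialReduction {I J : Finset (Fin n)} {p : SubdivPoly n}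
    (h : IsLongestPairReducedForm I J p) : IsPartialReduction I J p := by
  obtain ⟨h1, -⟩ := h
  induction h1 with
  | refl => exact isPartialReduction_monomialG I J
  | tail _ hs ih => exact ih.step hs

/-! ### Reduced forms exist -/

/-- A weight of monomials that drops in every reduction: longer edges weigh less. On edges `(i, j)`
with `i < j` neither subtraction is truncated. -/
def weight (m : (Fin n × Fin n) →₀ ℕ) : ℕ := m.sum fun e a => a * (n - (e.2.val - e.1.val))

lemma weight_add (m m' : (Fin n × Fin n) →₀ ℕ) : weight (m + m') = weight m + weight m' :=
  Finsupp.sum_add_index' (by simp) (by intros; ring)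

lemma weight_single (e : Fin n × Fin n) :
    weight (Finsupp.single e 1) = n - (e.2.val - e.1.val) := by
  simp [weight]

lemma weight_lt {i j k : Fin n} (hij : i < j) (hjk : j < k) {m : (Fin n × Fin n) →₀ ℕ}
    (h : pairExp i j k ≤ m) : weight (expRight i j k m) < weight m ∧
      weight (expLeft i j k m) < weight m ∧ weight (expBoth i j k m) < weight m := by
  obtain ⟨d, rfl⟩ := exists_add_of_le h
  simp only [expRight, expLeft, expBoth, add_tsub_cancel_left, pairExp, weight_add, weight_single]
  have := k.isLt
  rw [Fin.lt_def] at hij hjk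
  omega

lemma sum_biUnion_le {ι κ : Type*} [DecidableEq κ] (s : Finset ι) (g : ι → Finset κ) (f : κ → ℕ) :
    ∑ x ∈ s.biUnion g, f x ≤ ∑ i ∈ s, ∑ x ∈ g i, f x := by
  classical
  induction s using Finset.induction_on with
  | empty => simp
  | insert i s hi ih =>
    rw [Finset.biUnion_insert, Finset.sum_insert hi]
    have := Finset.sum_union_inter (f := f) (s₁ := g i) (s₂ := s.biUnion g)
    omega

/-- Each reduced monomial is replaced by at most three of smaller weight. -/
lemma sum_weight_reduceAt_lt {i j k : Fin n} (hij : i < j) (hjk : j < k) {p : SubdivPoly n}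
    {m₀ : (Fin n × Fin n) →₀ ℕ} (hm₀ : m₀ ∈ p.support) (h₀ : pairExp i j k ≤ m₀) :
    ∑ m ∈ (reduceAt i j k p).support, 4 ^ weight m < ∑ m ∈ p.support, 4 ^ weight m := by
  classical
  let g : ((Fin n × Fin n) →₀ ℕ) → Finset ((Fin n × Fin n) →₀ ℕ) := fun m =>
    if pairExp i j k ≤ m then {expRight i j k m, expLeft i j k m, expBoth i j k m} else {m}
  have hsub : (reduceAt i j k p).support ⊆ p.support.biUnion g := by
    intro m' hm'
    rw [Finset.mem_biUnion]
    rcases mem_support_reduceAt hm' with ⟨h1, h2⟩ | ⟨m, hm, h1, h2⟩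
    · exact ⟨m', h1, by simp [g, h2]⟩
    · exact ⟨m, hm, by simpa [g, h1] using h2⟩
  have hlt : ∀ m, pairExp i j k ≤ m → ∑ m' ∈ g m, 4 ^ weight m' < 4 ^ weight m := by
    intro m hm
    obtain ⟨h1, h2, h3⟩ := weight_lt hij hjk hm
    obtain ⟨w, hw⟩ : ∃ w, weight m = w + 1 := ⟨weight m - 1, by omega⟩
    have hb : ∀ m' ∈ g m, 4 ^ weight m' ≤ 4 ^ w := by
      intro m' hm'
      refine Nat.pow_le_pow_right (by norm_num) ?_
      simp only [g, hm, if_true, Finset.mem_insert, Finset.mem_singleton] at hm'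
      rcases hm' with rfl | rfl | rfl <;> omega
    have hc : (g m).card ≤ 3 := by
      simp only [g, hm, if_true]; exact Finset.card_le_three
    calc ∑ m' ∈ g m, 4 ^ weight m' ≤ (g m).card * 4 ^ w := by
          simpa using Finset.sum_le_card_nsmul _ _ _ hb
      _ ≤ 3 * 4 ^ w := Nat.mul_le_mul_right _ hc
      _ < 4 ^ weight m := by
          rw [hw, pow_succ]
          have : 0 < 4 ^ w := by positivity
          omega
  calc ∑ m ∈ (reduceAt i j k p).support, 4 ^ weight m
      ≤ ∑ m ∈ p.support.biUnion g, 4 ^ weight m :=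
        Finset.sum_le_sum_of_subset hsub
    _ ≤ ∑ m ∈ p.support, ∑ m' ∈ g m, 4 ^ weight m' :=
        sum_biUnion_le _ _ _
    _ < ∑ m ∈ p.support, 4 ^ weight m := by
        refine Finset.sum_lt_sum (fun m _ => ?_) ⟨m₀, hm₀, hlt m₀ h₀⟩
        by_cases hm : pairExp i j k ≤ m
        · exact (hlt m hm).le
        · simp [g, hm]

/-- A step of the length reduction order is possible in every polynomial that is not reduced:
over all non-alternating pairs `(i, j)`, `(j, k)` in all monomials take `j` least, then `i` least,
then `k` greatest. -/
lemma exists_lengthOrderStep {p : SubdivPoly n} (hp : ¬ IsReduced p) :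
    ∃ q, LengthOrderStep p q ∧
      ∑ m ∈ q.support, 4 ^ weight m < ∑ m ∈ p.support, 4 ^ weight m := by
  classical
  let S : Finset (Fin n × Fin n × Fin n) := Finset.univ.filter fun t =>
    ∃ m ∈ p.support, NonAlternating (graphOf m) t.2.1 t.1 t.2.2
  have hmem : ∀ {m}, m ∈ p.support → ∀ {i j k}, NonAlternating (graphOf m) i j k →
      (j, i, k) ∈ S := fun hm _ _ _ h => Finset.mem_filter.2 ⟨Finset.mem_univ _, _, hm, h⟩
  have hS : S.Nonempty := by
    unfold IsReduced at hp
    push Not at hp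
    obtain ⟨m, hm, i, j, k, h⟩ := hp
    exact ⟨_, hmem hm h⟩
  obtain ⟨⟨j, i, k⟩, ht, hmin⟩ := S.exists_min_image
    (fun t => toLex (t.1, toLex (t.2.1, OrderDual.toDual t.2.2))) hS
  obtain ⟨-, m₀, hm₀, h₀⟩ := Finset.mem_filter.1 ht
  have hj : ∀ {j' i' k'}, (j', i', k') ∈ S → j ≤ j' := fun h => by
    have := hmin _ h
    simp only [Prod.Lex.toLex_le_toLex] at this
    grind
  have hi : ∀ {i' k'}, (j, i', k') ∈ S → i ≤ i' := fun h => by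
    have := hmin _ h
    simp only [Prod.Lex.toLex_le_toLex, lt_irrefl, false_or, true_and] at this
    grind
  have hk : ∀ {k'}, (j, i, k') ∈ S → k' ≤ k := fun h => by
    have := hmin _ h
    simpa only [Prod.Lex.toLex_le_toLex, lt_irrefl, false_or, true_and,
      OrderDual.toDual_le_toDual] using this
  refine ⟨reduceAt i j k p, ⟨i, j, k, ⟨m₀, hm₀, h₀⟩, fun m hm hna => ⟨⟨hna, ?_, ?_⟩, ?_⟩, rfl⟩,
    sum_weight_reduceAt_lt h₀.1 h₀.2.1 hm₀ ((pairExp_le_iff h₀.1 h₀.2.1).2 h₀)⟩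
  · rintro ⟨i', hi', he⟩
    exact absurd hi' (not_lt.2 (hi (hmem hm ⟨hi'.trans hna.1, hna.2.1, he, hna.2.2.2⟩)))
  · rintro ⟨k', hk', he⟩
    exact absurd hk' (not_lt.2 (hk (hmem hm ⟨hna.1, hna.2.1.trans hk', hna.2.2.1, he⟩)))
  · intro i' j' k' h
    exact hj (hmem hm h.1)

lemma exists_isLengthReducedForm (I J : Finset (Fin n)) : ∃ p, IsLengthReducedForm I J p := by
  suffices H : ∀ N (p : SubdivPoly n), ∑ m ∈ p.support, 4 ^ weight m = N →
      ∃ q, Relation.ReflTransGen LengthOrderStep p q ∧ IsReduced q from H _ _ rfl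
  intro N
  induction N using Nat.strong_induction_on with
  | _ N ih =>
    intro p hp
    by_cases hr : IsReduced p
    · exact ⟨p, Relation.ReflTransGen.refl, hr⟩
    · obtain ⟨q, hq, hlt⟩ := exists_lengthOrderStep hr
      obtain ⟨r, h1, h2⟩ := ih _ (hp ▸ hlt) q rfl
      exact ⟨r, Relation.ReflTransGen.head hq h1, h2⟩

/-! ### Noncrossing matrices with given marginals -/

/-- A nonnegative matrix supported on noncrossing arcs is determined by its marginals: at a
shortest arc where two such matrices differ, the one with the smaller entry would need two longer
arcs which cross. -/
lemma eq_of_marginals {x y : Fin n → Fin n → ℝ} (hx : ∀ i j, 0 ≤ x i j) (hy : ∀ i j, 0 ≤ y i j)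
    (hxs : ∀ i j, x i j ≠ 0 → i ≤ j) (hys : ∀ i j, y i j ≠ 0 → i ≤ j)
    (hxc : ∀ i j i' j', x i j ≠ 0 → x i' j' ≠ 0 → i < i' → i' ≤ j → ¬ j < j')
    (hyc : ∀ i j i' j', y i j ≠ 0 → y i' j' ≠ 0 → i < i' → i' ≤ j → ¬ j < j')
    (hrow : ∀ i, ∑ j, x i j = ∑ j, y i j) (hcol : ∀ j, ∑ i, x i j = ∑ i, y i j) : x = y := by
  -- by strong induction on the length of the arc
  suffices H : ∀ d i j, j.val - i.val = d → x i j = y i j by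
    funext i j; exact H _ i j rfl
  intro d
  induction d using Nat.strong_induction_on with
  | _ d ih =>
  have key : ∀ x y : Fin n → Fin n → ℝ, (∀ i j, 0 ≤ x i j) → (∀ i j, x i j ≠ 0 → i ≤ j) →
      (∀ i j, y i j ≠ 0 → i ≤ j) →
      (∀ i j i' j', y i j ≠ 0 → y i' j' ≠ 0 → i < i' → i' ≤ j → ¬ j < j') →
      (∀ i, ∑ j, x i j = ∑ j, y i j) → (∀ j, ∑ i, x i j = ∑ i, y i j) →
      (∀ m < d, ∀ i j : Fin n, j.val - i.val = m → x i j = y i j) →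
      (∀ i j, 0 ≤ y i j) → ∀ i j, j.val - i.val = d → x i j ≤ y i j := by
    intro x y hx hxs hys hyc hrow hcol ih hy i j hd
    by_contra! hlt
    have hij : i ≤ j := hxs i j (ne_of_gt ((hy i j).trans_lt hlt))
    obtain ⟨j', -, hj'⟩ : ∃ j' ∈ Finset.univ, x i j' < y i j' := by
      by_contra! hc
      exact (Finset.sum_lt_sum hc ⟨j, Finset.mem_univ _, hlt⟩).ne (hrow i).symm
    obtain ⟨i', -, hi'⟩ : ∃ i' ∈ Finset.univ, x i' j < y i' j := by
      by_contra! hc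
      exact (Finset.sum_lt_sum hc ⟨i, Finset.mem_univ _, hlt⟩).ne (hcol j).symm
    have h1 : y i j' ≠ 0 := ne_of_gt ((hx i j').trans_lt hj')
    have h2 : y i' j ≠ 0 := ne_of_gt ((hx i' j).trans_lt hi')
    have h3 := hys _ _ h1
    have h4 := hys _ _ h2
    have h5 : ¬ j'.val - i.val < d := fun h => hj'.ne (ih _ h i j' rfl)
    have h6 : ¬ j.val - i'.val < d := fun h => hi'.ne (ih _ h i' j rfl)
    have h7 : j' ≠ j := by rintro rfl; exact lt_asymm hj' hlt
    have h8 : i' ≠ i := by rintro rfl; exact lt_asymm hi' hlt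
    rw [Fin.le_def] at hij h3 h4
    rw [Ne, Fin.ext_iff] at h7 h8
    exact hyc i' j i j' h2 h1 (Fin.lt_def.2 (by omega)) (Fin.le_def.2 hij)
      (Fin.lt_def.2 (by omega))
  intro i j hd
  exact le_antisymm (key x y hx hxs hys hyc hrow hcol ih hy i j hd)
    (key y x hy hys hxs hxc (fun i => (hrow i).symm) (fun j => (hcol j).symm)
      (fun m hm i j h => (ih m hm i j h).symm) hx i j hd)

/-- The height of the lattice path that goes up by `a k` and then down by `b k`, for each `k`. -/
def height (a b : ℕ → ℝ) (c : ℕ) : ℝ := ∑ k ∈ Finset.range c, (a k - b k)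

/-- The lowest point of the lattice path from just after the up-step `i` to just before the
down-step `i + d`. -/
def lowest (a b : ℕ → ℝ) (i : ℕ) : ℕ → ℝ
  | 0 => height a b i + a i
  | d + 1 => min (lowest a b i d) (height a b (i + d + 1))

/-- The matching of up-steps with down-steps in a lattice path: a level crossed by the up-step `i`
is matched with the first later down-step that crosses it. -/
def matching (a b : ℕ → ℝ) (i j : ℕ) : ℝ :=
  if i ≤ j then max (lowest a b i (j - i)) (height a b i) -
    max (lowest a b i (j - i + 1)) (height a b i) else 0

section Matching

variable {a b : ℕ → ℝ}

lemma height_succ (a b : ℕ → ℝ) (c : ℕ) : height a b (c + 1) = height a b c + a c - b c := by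
  rw [height, height, Finset.sum_range_succ]; ring

lemma lowest_le (a b : ℕ → ℝ) {i d k : ℕ} (h1 : i < k) (h2 : k ≤ i + d) :
    lowest a b i d ≤ height a b k := by
  induction d with
  | zero => omega
  | succ d ih =>
    rcases Nat.lt_or_ge (i + d) k with h | h
    · have : k = i + d + 1 := by omega
      subst this; exact min_le_right _ _
    · exact (min_le_left _ _).trans (ih h)

lemma lowest_succ' (ha : ∀ k, 0 ≤ a k) (hb : ∀ k, 0 ≤ b k) (i d : ℕ) :
    lowest a b i (d + 1) = min (height a b (i + 1)) (lowest a b (i + 1) d) := by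
  induction d with
  | zero =>
    have h1 := height_succ a b i
    simp only [lowest, add_zero]
    rw [min_eq_right (by linarith [hb i]), min_eq_left (by linarith [ha (i + 1)])]
  | succ d ih =>
    rw [lowest, ih, lowest, min_assoc]
    congr 3; ring

lemma matching_eq (a b : ℕ → ℝ) {i j : ℕ} (h : i ≤ j) : matching a b i j =
    max (lowest a b i (j - i)) (height a b (j + 1)) -
      max (min (height a b i) (lowest a b i (j - i))) (height a b (j + 1)) := by
  rw [matching, if_pos h, lowest, show i + (j - i) + 1 = j + 1 by omega]
  generalize lowest a b i (j - i) = u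
  generalize height a b i = p
  generalize height a b (j + 1) = q
  grind

lemma matching_nonneg (a b : ℕ → ℝ) (i j : ℕ) : 0 ≤ matching a b i j := by
  rw [matching]
  split_ifs
  · exact sub_nonneg.2 (max_le_max (min_le_left _ _) le_rfl)
  · exact le_rfl

lemma matching_ne_zero {i j : ℕ} (h : matching a b i j ≠ 0) :
    i ≤ j ∧ height a b i < lowest a b i (j - i) ∧ height a b (j + 1) < lowest a b i (j - i) := by
  have hij : i ≤ j := by
    by_contra hc; exact h (if_neg hc)
  refine ⟨hij, ?_, ?_⟩ <;> by_contra! hc <;> apply h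
  · rw [matching, if_pos hij, max_eq_right hc, lowest, max_eq_right ((min_le_left _ _).trans hc),
      sub_self]
  · rw [matching_eq a b hij, max_eq_right hc, max_eq_right ((min_le_right _ _).trans hc), sub_self]

/-- Matched pairs of steps do not cross. -/
lemma matching_noncrossing {i j i' j' : ℕ} (h : matching a b i j ≠ 0)
    (h' : matching a b i' j' ≠ 0) (h1 : i < i') (h2 : i' ≤ j) : ¬ j < j' := by
  intro h3
  obtain ⟨-, -, h5⟩ := matching_ne_zero h
  obtain ⟨h6, h7, -⟩ := matching_ne_zero h'
  have h8 := lowest_le a b h1 (show i' ≤ i + (j - i) by omega)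
  have h9 := lowest_le a b (show i' < j + 1 by omega) (show j + 1 ≤ i' + (j' - i') by omega)
  linarith

lemma sum_matching_row {N i : ℕ} (hi : i < N) (ha : ∀ k, 0 ≤ a k)
    (hH : 0 ≤ height a b i) (hN : height a b N = 0) :
    ∑ j ∈ Finset.range N, matching a b i j = a i := by
  have hsum : ∀ M, ∑ j ∈ Finset.range (i + M), matching a b i j =
      max (lowest a b i 0) (height a b i) - max (lowest a b i M) (height a b i) := by
    intro M
    induction M with
    | zero =>
      rw [sub_self]
      refine Finset.sum_eq_zero fun j hj => if_neg ?_
      have := Finset.mem_range.1 hj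
      omega
    | succ M ih =>
      rw [← add_assoc, Finset.sum_range_succ, ih, matching, if_pos (Nat.le_add_right _ _),
        Nat.add_sub_cancel_left]
      ring
  have h1 := hsum (N - i)
  rw [Nat.add_sub_cancel' hi.le] at h1
  have h2 := lowest_le a b hi (show N ≤ i + (N - i) by omega)
  rw [h1, max_eq_right (h2.trans (hN.trans_le hH)), lowest, max_eq_left (by linarith [ha i])]
  ring

lemma sum_matching_col {N j : ℕ} (hj : j < N) (ha : ∀ k, 0 ≤ a k) (hb : ∀ k, 0 ≤ b k)
    (hH : 0 ≤ height a b (j + 1)) :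
    ∑ i ∈ Finset.range N, matching a b i j = b j := by
  -- partial sums over the sources from `j - d` to `j`
  have hsum : ∀ d ≤ j, ∑ i ∈ Finset.Ico (j - d) N, matching a b i j =
      max (lowest a b j 0) (height a b (j + 1)) -
        max (min (height a b (j - d)) (lowest a b (j - d) d)) (height a b (j + 1)) := by
    intro d hd
    induction d with
    | zero =>
      rw [Finset.sum_eq_single j]
      · rw [matching_eq a b le_rfl]; simp
      · intro i hi hne
        refine if_neg ?_
        have := Finset.mem_Ico.1 hi
        omega
      · intro h; exact absurd (Finset.mem_Ico.2 ⟨by omega, hj⟩) h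
    | succ d ih =>
      obtain ⟨t, ht⟩ : ∃ t, j - (d + 1) = t := ⟨_, rfl⟩
      have h1 : j - d = t + 1 := by omega
      have h2 : j - t = d + 1 := by omega
      rw [ht, Finset.sum_eq_sum_Ico_succ_bot (by omega), ← h1, ih (by omega),
        matching_eq a b (show t ≤ j by omega), h2, lowest_succ' ha hb, h1]
      ring
  have h1 := hsum j le_rfl
  have h0 : height a b 0 = 0 := by simp [height]
  have h2 := height_succ a b j
  rw [Nat.sub_self, h0, max_eq_right ((min_le_left _ _).trans hH), lowest,
    max_eq_left (by linarith [hb j])] at h1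
  rw [Finset.range_eq_Ico, h1]
  linarith

end Matching

/-- Nonnegative marginals `a` and `b` of equal total, such that the partial sums of `a` dominate
those of `b`, are the marginals of a nonnegative matrix supported on noncrossing arcs. -/
lemma exists_noncrossing {a b : Fin n → ℝ} (ha : ∀ i, 0 ≤ a i) (hb : ∀ j, 0 ≤ b j)
    (hab : ∀ c : Fin n, ∑ j with j < c, b j ≤ ∑ i with i < c, a i)
    (htot : ∑ i, a i = ∑ j, b j) :
    ∃ x : Fin n → Fin n → ℝ, (∀ i j, 0 ≤ x i j) ∧ (∀ i j, x i j ≠ 0 → i ≤ j) ∧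
      (∀ i j i' j', x i j ≠ 0 → x i' j' ≠ 0 → i < i' → i' ≤ j → ¬ j < j') ∧
      (∀ i, ∑ j, x i j = a i) ∧ (∀ j, ∑ i, x i j = b j) := by
  let ext : (Fin n → ℝ) → ℕ → ℝ := fun f k => if h : k < n then f ⟨k, h⟩ else 0
  have hext : ∀ (f : Fin n → ℝ) (i : Fin n), ext f i = f i := fun f i => by simp [ext]
  have hpos : ∀ f : Fin n → ℝ, (∀ i, 0 ≤ f i) → ∀ k, 0 ≤ ext f k := fun f hf k => by
    simp only [ext]; split_ifs
    · exact hf _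
    · exact le_rfl
  have hpart : ∀ (f : Fin n → ℝ) (c : ℕ), c ≤ n →
      ∑ k ∈ Finset.range c, ext f k = ∑ i with i.val < c, f i := by
    intro f c hc
    have h := Finset.sum_range (n := n) fun k => if k < c then ext f k else 0
    simp only [hext] at h
    rw [Finset.sum_filter, ← h, ← Finset.sum_filter]
    refine Finset.sum_congr ?_ fun _ _ => rfl
    ext k
    simp only [Finset.mem_range, Finset.mem_filter]
    omega
  have hheight : ∀ c ≤ n, 0 ≤ height (ext a) (ext b) c := by
    intro c hc
    rw [height, Finset.sum_sub_distrib, hpart a c hc, hpart b c hc, sub_nonneg]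
    rcases hc.lt_or_eq with h | rfl
    · exact hab ⟨c, h⟩
    · simp [htot]
  have hend : height (ext a) (ext b) n = 0 := by
    rw [height, Finset.sum_sub_distrib, hpart a n le_rfl, hpart b n le_rfl]
    simp [htot]
  have ha' := hpos a ha
  have hb' := hpos b hb
  refine ⟨fun i j => matching (ext a) (ext b) i j, fun i j => matching_nonneg _ _ _ _,
    fun i j h => (matching_ne_zero h).1, fun i j i' j' h h' h1 h2 =>
      matching_noncrossing h h' h1 h2, fun i => ?_, fun j => ?_⟩
  · rw [← Finset.sum_range fun j => matching (ext a) (ext b) i j,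
      sum_matching_row i.isLt ha' (hheight _ i.isLt.le) hend, hext]
  · rw [← Finset.sum_range fun i => matching (ext a) (ext b) i j,
      sum_matching_col j.isLt ha' hb' (hheight _ j.isLt), hext]

/-! ### Simplicial complexes from unique representations -/

section Realization

variable {ι E : Type*} [Fintype ι] [AddCommGroup E] [Module ℝ E]

/-- Nonnegative combinations of the points `p` with coefficients supported on a face of `K` are
unique: the cones over the faces of `K` form a simplicial fan. -/
def UniqueCombinations (K : AbstractSimplicialComplex ι) (p : ι → E) : Prop :=
  ∀ F ∈ K.faces, ∀ F' ∈ K.faces, ∀ x y : ι → ℝ, (∀ a, 0 ≤ x a) → (∀ a, 0 ≤ y a) →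
    (∀ a, x a ≠ 0 → a ∈ F) → (∀ a, y a ≠ 0 → a ∈ F') → ∑ a, x a • p a = ∑ a, y a • p a → x = y

variable {K : AbstractSimplicialComplex ι} {p : ι → E}

open Classical in
lemma UniqueCombinations.injective (h : UniqueCombinations K p) : Function.Injective p := by
  intro a b hab
  have := h {a} (K.singleton_mem a) {b} (K.singleton_mem b) (Pi.single a 1) (Pi.single b 1)
    (fun c => by by_cases hc : c = a <;> simp [hc])
    (fun c => by by_cases hc : c = b <;> simp [hc])
    (fun c hc => by by_contra hn; simp_all [Pi.single_apply])
    (fun c hc => by by_contra hn; simp_all [Pi.single_apply])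
    (by simp [Pi.single_apply, hab])
  by_contra hne
  have := congrFun this a
  simp [hne] at this

lemma mem_convexHull_image_iff [DecidableEq E] {F : Finset ι} (hp : Function.Injective p) {z : E} :
    z ∈ convexHull ℝ (F.image p : Set E) ↔ ∃ x : ι → ℝ, (∀ a, 0 ≤ x a) ∧ (∀ a, x a ≠ 0 → a ∈ F) ∧
      ∑ a, x a = 1 ∧ ∑ a, x a • p a = z := by
  have : DecidableEq ι := Classical.decEq ι
  rw [Finset.mem_convexHull']
  constructor
  · rintro ⟨w, h1, h2, h3⟩
    rw [Finset.sum_image fun _ _ _ _ h => hp h] at h2 h3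
    refine ⟨fun a => if a ∈ F then w (p a) else 0, fun a => ?_, fun a ha => ?_, ?_, ?_⟩
    · dsimp only; split_ifs with h
      · exact h1 _ (Finset.mem_image_of_mem p h)
      · exact le_rfl
    · by_contra hc; exact ha (if_neg hc)
    · simpa using h2
    · simpa using h3
  · rintro ⟨x, h1, h2, h3, h4⟩
    have hinv : ∀ a, Function.extend p x 0 (p a) = x a := hp.extend_apply x 0
    refine ⟨Function.extend p x 0, ?_, ?_, ?_⟩
    · intro y hy
      obtain ⟨a, -, rfl⟩ := Finset.mem_image.1 hy
      rw [hinv]; exact h1 a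
    · rw [Finset.sum_image fun _ _ _ _ h => hp h, ← h3]
      simp only [hinv]
      exact Finset.sum_subset (Finset.subset_univ _) fun a _ ha => by
        by_contra hc; exact ha (h2 a hc)
    · rw [Finset.sum_image fun _ _ _ _ h => hp h, ← h4]
      simp only [hinv]
      refine Finset.sum_subset (Finset.subset_univ _) fun a _ ha => ?_
      have : x a = 0 := by by_contra hc; exact ha (h2 a hc)
      rw [this, zero_smul]

open Classical in
lemma UniqueCombinations.affineIndependent (h : UniqueCombinations K p) {F : Finset ι}
    (hF : F ∈ K.faces) :
    AffineIndependent ℝ ((↑) : ((F.image p : Finset E) : Set E) → E) := by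
  have h1 : AffineIndependent ℝ (fun a : F => p a) := by
    refine LinearIndependent.affineIndependent ℝ (Fintype.linearIndependent_iff.2 fun g hg a => ?_)
    -- the positive and the negative part of a linear relation on a face agree by uniqueness
    let g' : ι → ℝ := fun a => if ha : a ∈ F then g ⟨a, ha⟩ else 0
    have hg' : ∑ a, g' a • p a = 0 := by
      rw [← hg, ← Finset.sum_subset (Finset.subset_univ F) (fun a _ ha => by simp [g', ha]),
        ← Finset.sum_coe_sort F fun a => g' a • p a]
      exact Finset.sum_congr rfl fun a _ => by simp [g']
    have hsupp : ∀ a, a ∉ F → g' a = 0 := fun a ha => dif_neg ha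
    have hsub : ∀ a, max (g' a) 0 - max (-g' a) 0 = g' a := fun a => by
      rcases le_total (g' a) 0 with h | h
      · rw [max_eq_right h, max_eq_left (by linarith)]; ring
      · rw [max_eq_left h, max_eq_right (by linarith)]; ring
    have key := h F hF F hF (fun a => max (g' a) 0) (fun a => max (-g' a) 0)
      (fun a => le_max_right _ _) (fun a => le_max_right _ _)
      (fun a ha => by by_contra hn; simp [hsupp a hn] at ha)
      (fun a ha => by by_contra hn; simp [hsupp a hn] at ha)
      (by rw [← sub_eq_zero, ← Finset.sum_sub_distrib, ← hg']
          exact Finset.sum_congr rfl fun a _ => by rw [← sub_smul, hsub])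
    have h0 : g' a = 0 := by rw [← hsub a, sub_eq_zero]; exact congrFun key a
    simpa [g'] using h0
  have h2 := h1.range
  refine h2.mono ?_
  intro y hy
  obtain ⟨a, ha, rfl⟩ := Finset.mem_image.1 hy
  exact ⟨⟨a, ha⟩, rfl⟩

open Classical in
/-- The geometric simplicial complex with vertices `p a` and the combinatorics of `K`. -/
def UniqueCombinations.complex (h : UniqueCombinations K p) :
    Geometry.SimplicialComplex ℝ E where
  faces := (fun F => F.image p) '' K.faces
  isRelLowerSet_faces := by
    rintro _ ⟨F, hF, rfl⟩
    refine ⟨(K.isRelLowerSet_faces hF).1.image p, fun t ht hne => ?_⟩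
    obtain ⟨F', hF', rfl⟩ := Finset.subset_image_iff.1 ht
    exact ⟨F', (K.isRelLowerSet_faces hF).2 hF' (Finset.image_nonempty.1 hne), rfl⟩
  indep := by
    rintro _ ⟨F, hF, rfl⟩
    exact h.affineIndependent hF
  inter_subset_convexHull := by
    rintro _ _ ⟨F, hF, rfl⟩ ⟨F', hF', rfl⟩ z ⟨h1, h2⟩
    obtain ⟨x, hx1, hx2, hx3, hx4⟩ := (mem_convexHull_image_iff h.injective).1 h1
    obtain ⟨y, hy1, hy2, hy3, hy4⟩ := (mem_convexHull_image_iff h.injective).1 h2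
    obtain rfl := h F hF F' hF' x y hx1 hy1 hx2 hy2 (hx4.trans hy4.symm)
    rw [← Finset.coe_inter, ← Finset.image_inter _ _ h.injective]
    exact (mem_convexHull_image_iff h.injective).2
      ⟨x, hx1, fun a ha => Finset.mem_inter.2 ⟨hx2 a ha, hy2 a ha⟩, hx3, hx4⟩

lemma UniqueCombinations.faces_complex [DecidableEq E] (h : UniqueCombinations K p) :
    h.complex.faces = (fun F => F.image p) '' K.faces := by
  obtain rfl : ‹DecidableEq E› = fun a b => Classical.propDecidable (a = b) :=
    Subsingleton.elim _ _
  rfl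

lemma UniqueCombinations.mem_faces_iff (h : UniqueCombinations K p) {σ : Finset E} :
    σ ∈ h.complex.faces ↔ ∃ F ∈ K.faces, (σ : Set E) = p '' F := by
  classical
  rw [h.faces_complex, Set.mem_image]
  refine exists_congr fun F => and_congr_right fun _ => ?_
  rw [← Finset.coe_image, Finset.coe_inj, eq_comm]

lemma UniqueCombinations.exists_mem_faces (h : UniqueCombinations K p) {F : Finset ι}
    (hF : F ∈ K.faces) : ∃ σ ∈ h.complex.faces, (σ : Set E) = p '' F := by
  classical
  exact ⟨F.image p, h.mem_faces_iff.2 ⟨F, hF, Finset.coe_image⟩, Finset.coe_image⟩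

lemma UniqueCombinations.mem_faces_of_subset (h : UniqueCombinations K p) {F : Finset ι}
    (hF : F ∈ K.faces) {σ : Finset E} (hσ : σ.Nonempty) (hsub : (σ : Set E) ⊆ p '' F) :
    σ ∈ h.complex.faces := by
  obtain ⟨τ, hτ, h'⟩ := h.exists_mem_faces hF
  exact h.complex.down_closed hτ (Finset.coe_subset.1 (h'.symm ▸ hsub)) hσ

lemma UniqueCombinations.card_eq (h : UniqueCombinations K p) {F : Finset ι} {σ : Finset E}
    (hσ : (σ : Set E) = p '' F) : σ.card = F.card := by
  classical
  rw [← Finset.coe_image, Finset.coe_inj] at hσ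
  rw [hσ, Finset.card_image_of_injective _ h.injective]

open Classical in
lemma UniqueCombinations.faces_map {E' : Type*} [AddCommGroup E'] [Module ℝ E'] {q : ι → E'}
    (h : UniqueCombinations K p) (h' : UniqueCombinations K q) {φ : E →ₗ[ℝ] E'}
    (hφ : ∀ a, φ (p a) = q a) : h'.complex.faces = (fun σ => σ.image φ) '' h.complex.faces := by
  rw [h.faces_complex, h'.faces_complex, Set.image_image]
  refine Set.image_congr fun F _ => ?_
  rw [Finset.image_image]
  exact Finset.image_congr fun a _ => (hφ a).symm

open Classical in
lemma UniqueCombinations.isGeometricRealization (h : UniqueCombinations K p) :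
    IsGeometricRealization K h.complex :=
  ⟨p, h.injective, h.faces_complex⟩

lemma UniqueCombinations.mem_space_iff (h : UniqueCombinations K p) {z : E} :
    z ∈ h.complex.space ↔ ∃ F ∈ K.faces, ∃ x : ι → ℝ, (∀ a, 0 ≤ x a) ∧ (∀ a, x a ≠ 0 → a ∈ F) ∧
      ∑ a, x a = 1 ∧ ∑ a, x a • p a = z := by
  classical
  rw [Geometry.SimplicialComplex.mem_space_iff, h.faces_complex, Set.exists_mem_image]
  exact exists_congr fun F => and_congr_right fun _ => mem_convexHull_image_iff h.injective

end Realization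

/-! ### The associahedral triangulation of `U_{I,J̄}` -/

lemma mem_arcs {i j : Fin n} : (i, j) ∈ arcs I J ↔ i ∈ I ∧ j ∈ J ∧ i ≤ j := by
  simp only [arcs, Finset.mem_filter, Finset.mem_product, and_assoc]
  simp only [Prec, pos, Fin.le_def]
  refine and_congr_right fun _ => and_congr_right fun _ => ?_
  omega

lemma crosses_iff {a b : Fin n × Fin n} : Crosses a b ↔ a.1 < b.1 ∧ b.1 ≤ a.2 ∧ a.2 < b.2 := by
  simp only [Crosses, Prec, pos, Fin.le_def, Fin.lt_def]
  omega

/-- Weights on the arcs as a matrix. -/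
def arcMatrix (x : arcs I J → ℝ) (i j : Fin n) : ℝ :=
  if h : (i, j) ∈ arcs I J then x ⟨(i, j), h⟩ else 0

lemma arcMatrix_coe (x : arcs I J → ℝ) (a : arcs I J) : arcMatrix x a.1.1 a.1.2 = x a :=
  dif_pos a.2

lemma sum_arcs_smul {E : Type*} [AddCommGroup E] [Module ℝ E] (x : arcs I J → ℝ)
    (p : Fin n → Fin n → E) :
    ∑ a, x a • p a.1.1 a.1.2 = ∑ i, ∑ j, arcMatrix x i j • p i j := by
  rw [← Fintype.sum_prod_type' (f := fun i j => arcMatrix x i j • p i j),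
    ← Finset.sum_subset (Finset.subset_univ (arcs I J)),
    ← Finset.sum_coe_sort (arcs I J) fun e => arcMatrix x e.1 e.2 • p e.1 e.2]
  · exact Finset.sum_congr rfl fun a _ => by rw [arcMatrix_coe]
  · rintro ⟨i, j⟩ _ h
    rw [arcMatrix, dif_neg h, zero_smul]

lemma sum_smul_arcPoint (x : arcs I J → ℝ) : ∑ a, x a • arcPoint a.1 =
    (fun i => ∑ j, arcMatrix x i j, fun j => ∑ i, arcMatrix x i j) := by
  have h := sum_arcs_smul x fun i j => arcPoint (i, j)
  refine h.trans ?_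
  ext k
  · simp [arcPoint, Prod.fst_sum, Finset.sum_apply, Pi.single_apply]
  · simp [arcPoint, Prod.snd_sum, Finset.sum_apply, Pi.single_apply]

lemma arcMatrix_ne_zero {x : arcs I J → ℝ} {i j : Fin n} (h : arcMatrix x i j ≠ 0) :
    ∃ a : arcs I J, a.1 = (i, j) ∧ x a ≠ 0 := by
  unfold arcMatrix at h
  split_ifs at h with hmem
  · exact ⟨⟨(i, j), hmem⟩, rfl, h⟩
  · exact absurd rfl h

lemma uniqueCombinations_arcPoint (I J : Finset (Fin n)) :
    UniqueCombinations (tamariComplex I J) fun a : arcs I J => arcPoint a.1 := by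
  intro F hF F' hF' x y hx hy hxF hyF' hxy
  have hnn : ∀ z : arcs I J → ℝ, (∀ a, 0 ≤ z a) → ∀ i j, 0 ≤ arcMatrix z i j := fun z hz i j => by
    unfold arcMatrix; split_ifs
    · exact hz _
    · exact le_rfl
  have hs : ∀ (z : arcs I J → ℝ) (i j : Fin n), arcMatrix z i j ≠ 0 → i ≤ j := fun z i j h => by
    obtain ⟨⟨a, ha⟩, rfl, -⟩ := arcMatrix_ne_zero h
    exact (mem_arcs.1 ha).2.2
  have hc : ∀ (z : arcs I J → ℝ), ∀ F ∈ (tamariComplex I J).faces, (∀ a, z a ≠ 0 → a ∈ F) →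
      ∀ i j i' j', arcMatrix z i j ≠ 0 → arcMatrix z i' j' ≠ 0 → i < i' → i' ≤ j → ¬ j < j' := by
    intro z F hF hzF i j i' j' h h' h1 h2 h3
    obtain ⟨a, ha, hza⟩ := arcMatrix_ne_zero h
    obtain ⟨b, hb, hzb⟩ := arcMatrix_ne_zero h'
    refine hF.2 a (hzF a hza) b (hzF b hzb) (crosses_iff.2 ?_)
    rw [ha, hb]; exact ⟨h1, h2, h3⟩
  rw [sum_smul_arcPoint, sum_smul_arcPoint, Prod.mk.injEq] at hxy
  have key := eq_of_marginals (hnn x hx) (hnn y hy) (hs x) (hs y) (hc x F hF hxF)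
    (hc y F' hF' hyF') (congrFun hxy.1) (congrFun hxy.2)
  funext a
  rw [← arcMatrix_coe x, ← arcMatrix_coe y, key]

/-! ### Flows on `Ĝ(I, J̄)` -/

lemma mem_flowPolytope_iff {V : Type*} [DecidableEq V] [Fintype V] {E : Finset (V × V)} {s t : V}
    {x : E → ℝ} : x ∈ flowPolytope E s t ↔ (∀ e, 0 ≤ x e) ∧
      ∀ f : V → ℝ, ∑ e, x e * (f e.1.1 - f e.1.2) = f s - f t := by
  refine and_congr_right fun _ => ?_
  constructor
  · intro h f
    have h1 : ∀ g : E → V, ∑ e, x e * f (g e) = ∑ v, f v * ∑ e with g e = v, x e := by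
      intro g
      rw [← Finset.sum_fiberwise Finset.univ g]
      refine Finset.sum_congr rfl fun v _ => ?_
      rw [Finset.mul_sum]
      refine Finset.sum_congr rfl fun e he => ?_
      rw [(Finset.mem_filter.1 he).2, mul_comm]
    simp only [mul_sub, Finset.sum_sub_distrib]
    rw [h1 fun e => e.1.1, h1 fun e => e.1.2, ← Finset.sum_sub_distrib]
    simp only [← mul_sub, h]
    simp [mul_sub, Finset.sum_sub_distrib]
  · intro h v
    have := h fun u => if u = v then 1 else 0
    simpa [mul_sub, Finset.sum_sub_distrib, Finset.sum_filter, eq_comm] using this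

lemma innerV_injective : Function.Injective (innerV : Fin n → AugVertex n) := fun a b h => by
  simpa [innerV] using h

lemma innerV_ne_bot (i : Fin n) : innerV i ≠ ⊥ := WithBot.coe_ne_bot

lemma innerV_ne_top (i : Fin n) : innerV i ≠ ⊤ := by
  unfold innerV
  rw [← WithBot.coe_top, Ne, WithBot.coe_inj]
  exact WithTop.coe_ne_top

lemma mem_augEdges_inner {v w : Fin n} :
    (innerV v, innerV w) ∈ augEdges I J ↔ (v, w) ∈ graphG I J := by
  simp [augEdges, innerV_injective.eq_iff, (innerV_ne_bot _).symm, (innerV_ne_top _).symm]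

lemma mem_augEdges_bot {i : Fin n} : (⊥, innerV i) ∈ augEdges I J ↔ i ∈ I := by
  simp [augEdges, innerV_injective.eq_iff, innerV_ne_bot, (innerV_ne_top _).symm]

lemma mem_augEdges_top {v : Fin n} : (innerV v, ⊤) ∈ augEdges I J ↔ v ∈ precSet I J := by
  simp [augEdges, precSet, innerV_injective.eq_iff, innerV_ne_top, (innerV_ne_bot _).symm]

lemma sum_augEdges (g : AugVertex n × AugVertex n → ℝ) : ∑ e ∈ augEdges I J, g e =
    ∑ e ∈ graphG I J, g (innerV e.1, innerV e.2) + ∑ i ∈ I, g (⊥, innerV i) +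
      ∑ j ∈ J, g (innerV (prec I J j), ⊤) := by
  rw [augEdges, Finset.sum_union, Finset.sum_union, Finset.sum_image, Finset.sum_image,
    Finset.sum_image]
  · intro j hj j' hj' h
    exact prec_injOn I J hj hj' (innerV_injective (Prod.mk.inj h).1)
  · intro i _ i' _ h
    exact innerV_injective (Prod.mk.inj h).2
  · intro e _ e' _ h
    exact Prod.ext (innerV_injective (Prod.mk.inj h).1) (innerV_injective (Prod.mk.inj h).2)
  · rw [Finset.disjoint_left]
    intro e he he'
    obtain ⟨a, -, rfl⟩ := Finset.mem_image.1 he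
    obtain ⟨i, -, h⟩ := Finset.mem_image.1 he'
    exact innerV_ne_bot _ (Prod.mk.inj h).1.symm
  · rw [Finset.disjoint_left]
    intro e he he'
    obtain ⟨j, -, rfl⟩ := Finset.mem_image.1 he'
    rcases Finset.mem_union.1 he with he | he
    · obtain ⟨a, -, h⟩ := Finset.mem_image.1 he
      exact innerV_ne_top _ (Prod.mk.inj h).2
    · obtain ⟨a, -, h⟩ := Finset.mem_image.1 he
      exact innerV_ne_top _ (Prod.mk.inj h).2

/-- Extension by zero of a weight function on the edges. -/
def extendZero (x : augEdges I J → ℝ) (e : AugVertex n × AugVertex n) : ℝ :=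
  if h : e ∈ augEdges I J then x ⟨e, h⟩ else 0

lemma sum_mul_eq (x : augEdges I J → ℝ) (g : AugVertex n × AugVertex n → ℝ) :
    ∑ e, x e * g e.1 = ∑ e ∈ augEdges I J, extendZero x e * g e := by
  rw [← Finset.sum_coe_sort (augEdges I J) fun e => extendZero x e * g e]
  exact Finset.sum_congr rfl fun e _ => by rw [extendZero, dif_pos e.2]

lemma phi1_fst (x : augEdges I J → ℝ) (i : Fin n) :
    (phi1 I J x).1 i = extendZero x (⊥, innerV i) := by
  have h : (phi1 I J x).1 i =
      ∑ e, x e * if e.1 = (⊥, innerV i) then (1 : ℝ) else 0 := by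
    simp [phi1, Fintype.linearCombination_apply, Prod.fst_sum, Finset.sum_apply]
  refine h.trans ((sum_mul_eq x fun e => if e = (⊥, innerV i) then 1 else 0).trans ?_)
  simp only [mul_ite, mul_one, mul_zero, Finset.sum_ite_eq']
  rw [extendZero]
  split_ifs <;> rfl

lemma phi1_snd (x : augEdges I J → ℝ) (j : Fin n) :
    (phi1 I J x).2 j = if j ∈ J then extendZero x (innerV (prec I J j), ⊤) else 0 := by
  have h : (phi1 I J x).2 j = ∑ e, x e *
      if j ∈ J ∧ e.1 = (innerV (prec I J j), ⊤) then (1 : ℝ) else 0 := by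
    simp [phi1, Fintype.linearCombination_apply, Prod.snd_sum, Finset.sum_apply]
  refine h.trans ((sum_mul_eq x fun e =>
    if j ∈ J ∧ e = (innerV (prec I J j), ⊤) then 1 else 0).trans ?_)
  by_cases hj : j ∈ J
  · simp only [hj, true_and, mul_ite, mul_one, mul_zero, Finset.sum_ite_eq', if_true]
    rw [extendZero]
    split_ifs <;> rfl
  · simp [hj]

/-- Flow conservation tested against a function on the vertices, with the flow on the edges at `s`
and `t` read off from the image under `φ₁`. -/
lemma flow_identity {x : augEdges I J → ℝ} (hx : x ∈ flowPoly I J) (f : AugVertex n → ℝ) :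
    ∑ e ∈ graphG I J, extendZero x (innerV e.1, innerV e.2) * (f (innerV e.1) - f (innerV e.2)) +
      ∑ i, (phi1 I J x).1 i * (f ⊥ - f (innerV i)) +
      ∑ j, (phi1 I J x).2 j * (f (innerV (prec I J j)) - f ⊤) = f ⊥ - f ⊤ := by
  rw [← (mem_flowPolytope_iff.1 hx).2 f, sum_mul_eq x fun e => f e.1 - f e.2, sum_augEdges]
  congr 1
  · congr 1
    rw [← Finset.sum_subset (Finset.subset_univ I)]
    · exact Finset.sum_congr rfl fun i _ => by rw [phi1_fst]
    · intro i _ hi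
      rw [phi1_fst, extendZero, dif_neg (fun h => hi (mem_augEdges_bot.1 h)), zero_mul]
  · rw [← Finset.sum_subset (Finset.subset_univ J)]
    · exact Finset.sum_congr rfl fun j hj => by rw [phi1_snd, if_pos hj]
    · intro j _ hj
      rw [phi1_snd, if_neg hj, zero_mul]

lemma injOn_phi1 (I J : Finset (Fin n)) : Set.InjOn (phi1 I J) (flowPoly I J) := by
  intro x hx y hy hxy
  have hG := graphG_acyclic I J (fun e => extendZero x (innerV e.1, innerV e.2) -
    extendZero y (innerV e.1, innerV e.2)) (fun f => by
      -- the extension of `f` by zero at `s` and `t`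
      let f' : AugVertex n → ℝ := fun v => if h : ∃ i, innerV i = v then - f h.choose else 0
      have hf' : ∀ i, f' (innerV i) = - f i := fun i => by
        have h : ∃ k, innerV k = innerV i := ⟨i, rfl⟩
        simp only [f', dif_pos h, innerV_injective h.choose_spec]
      have h1 := flow_identity hx f'
      have h2 := flow_identity hy f'
      rw [hxy] at h1
      simp only [hf'] at h1 h2
      simp only [sub_mul, Finset.sum_sub_distrib]
      have e : ∀ e : Fin n × Fin n, f e.2 - f e.1 = - f e.1 - - f e.2 := fun e => by ring
      simp only [e]
      linarith)
  funext e
  have hext : ∀ z : augEdges I J → ℝ, z e = extendZero z e.1 := fun z => by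
    rw [extendZero, dif_pos e.2]
  rw [hext x, hext y]
  have he := e.2
  unfold augEdges at he
  rcases Finset.mem_union.1 he with he | he
  · rcases Finset.mem_union.1 he with he | he
    · obtain ⟨a, ha, h⟩ := Finset.mem_image.1 he
      rw [← h]
      exact sub_eq_zero.1 (hG a ha)
    · obtain ⟨i, hi, h⟩ := Finset.mem_image.1 he
      rw [← h, ← phi1_fst, ← phi1_fst, hxy]
  · obtain ⟨j, hj, h⟩ := Finset.mem_image.1 he
    have h1 := phi1_snd x j
    have h2 := phi1_snd y j
    rw [if_pos hj] at h1 h2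
    rw [← h, ← h1, ← h2, hxy]

lemma extendZero_nonneg {x : augEdges I J → ℝ} (hx : x ∈ flowPoly I J)
    (e : AugVertex n × AugVertex n) : 0 ≤ extendZero x e := by
  unfold extendZero; split_ifs
  · exact hx.1 _
  · exact le_rfl

lemma phi1_nonneg {x : augEdges I J → ℝ} (hx : x ∈ flowPoly I J) :
    (∀ i, 0 ≤ (phi1 I J x).1 i) ∧ ∀ j, 0 ≤ (phi1 I J x).2 j := by
  refine ⟨fun i => ?_, fun j => ?_⟩
  · rw [phi1_fst]; exact extendZero_nonneg hx _
  · rw [phi1_snd]; split_ifs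
    · exact extendZero_nonneg hx _
    · exact le_rfl

lemma sum_phi1 {x : augEdges I J → ℝ} (hx : x ∈ flowPoly I J) :
    ∑ i, (phi1 I J x).1 i = 1 ∧ ∑ j, (phi1 I J x).2 j = 1 := by
  constructor
  · simpa [innerV_ne_bot] using flow_identity hx fun v => if v = ⊥ then 1 else 0
  · have := flow_identity hx fun v => if v = ⊤ then -1 else 0
    simpa [innerV_ne_top] using this

/-- The flow that has entered at vertices before `c` is at least the flow that has left at sinks
before `c`. -/
lemma sum_phi1_le {x : augEdges I J → ℝ} (hx : x ∈ flowPoly I J) (c : Fin n) :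
    ∑ j with j < c, (phi1 I J x).2 j ≤ ∑ i with i < c, (phi1 I J x).1 i := by
  have h := flow_identity hx fun v => if v < innerV c then 1 else 0
  have hlt : ∀ i, innerV i < innerV c ↔ i < c := fun i => by simp [innerV]
  have hbot : (⊥ : AugVertex n) < innerV c := WithBot.bot_lt_coe _
  have htop : ¬ (⊤ : AugVertex n) < innerV c := not_top_lt
  simp only [hlt, hbot, htop, if_true, if_false, sub_zero] at h
  have h1 : 0 ≤ ∑ e ∈ graphG I J, extendZero x (innerV e.1, innerV e.2) *
      ((if e.1 < c then (1 : ℝ) else 0) - if e.2 < c then 1 else 0) := by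
    refine Finset.sum_nonneg fun e he => mul_nonneg (extendZero_nonneg hx _) ?_
    have := (mem_graphG.1 he).2.2.1
    by_cases h2 : e.2 < c
    · simp [h2, this.trans h2]
    · rw [if_neg h2, sub_zero]; split_ifs <;> norm_num
  have h2 : ∑ j with j < c, (phi1 I J x).2 j ≤
      ∑ j, (phi1 I J x).2 j * (if prec I J j < c then 1 else 0) := by
    rw [Finset.sum_filter]
    refine Finset.sum_le_sum fun j _ => ?_
    have := (phi1_nonneg hx).2 j
    by_cases hj : j < c
    · simp [hj, (prec_le I J j).trans_lt hj]
    · rw [if_neg hj]; split_ifs <;> simp [this]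
  have h3 : ∑ i, (phi1 I J x).1 i * (1 - if i < c then (1 : ℝ) else 0) =
      1 - ∑ i with i < c, (phi1 I J x).1 i := by
    simp [mul_sub, Finset.sum_sub_distrib, (sum_phi1 hx).1, Finset.sum_filter]
  linarith

/-- The image of a flow under `φ₁` is a convex combination of the points of noncrossing arcs. -/
lemma exists_forest_combination {x : augEdges I J → ℝ} (hx : x ∈ flowPoly I J) :
    ∃ F ∈ (tamariComplex I J).faces, ∃ y : arcs I J → ℝ, (∀ a, 0 ≤ y a) ∧
      (∀ a, y a ≠ 0 → a ∈ F) ∧ ∑ a, y a = 1 ∧ ∑ a, y a • arcPoint a.1 = phi1 I J x := by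
  classical
  obtain ⟨m, hm, hms, hmc, hrow, hcol⟩ := exists_noncrossing (phi1_nonneg hx).1 (phi1_nonneg hx).2
    (sum_phi1_le hx) ((sum_phi1 hx).1.trans (sum_phi1 hx).2.symm)
  have hmat : arcMatrix (I := I) (J := J) (fun a => m a.1.1 a.1.2) = m := by
    funext i j
    unfold arcMatrix
    split_ifs with h
    · rfl
    · by_contra hne
      have hne' : m i j ≠ 0 := fun h => hne h.symm
      have hpos := lt_of_le_of_ne (hm i j) hne'.symm
      have hi : 0 < (phi1 I J x).1 i := (hrow i) ▸ hpos.trans_le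
        (Finset.single_le_sum (fun j _ => hm i j) (Finset.mem_univ j))
      have hj : 0 < (phi1 I J x).2 j := (hcol j) ▸ hpos.trans_le
        (Finset.single_le_sum (f := fun i => m i j) (fun i _ => hm i j) (Finset.mem_univ i))
      apply h
      rw [mem_arcs]
      refine ⟨?_, ?_, hms i j hne'⟩
      · by_contra hI
        rw [phi1_fst, extendZero, dif_neg (fun h => hI (mem_augEdges_bot.1 h))] at hi
        exact lt_irrefl _ hi
      · by_contra hJ
        rw [phi1_snd, if_neg hJ] at hj
        exact lt_irrefl _ hj
  have hsum : ∑ a : arcs I J, m a.1.1 a.1.2 = 1 := by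
    have h := sum_arcs_smul (I := I) (J := J) (fun a => m a.1.1 a.1.2) fun _ _ => (1 : ℝ)
    rw [hmat] at h
    simpa [hrow, (sum_phi1 hx).1] using h
  refine ⟨Finset.univ.filter fun a => m a.1.1 a.1.2 ≠ 0, ⟨?_, ?_⟩, fun a => m a.1.1 a.1.2,
    fun a => hm _ _, fun a ha => Finset.mem_filter.2 ⟨Finset.mem_univ _, ha⟩, hsum, ?_⟩
  · obtain ⟨a, -, ha⟩ := Finset.exists_ne_zero_of_sum_ne_zero (hsum.trans_ne one_ne_zero)
    exact ⟨a, Finset.mem_filter.2 ⟨Finset.mem_univ _, ha⟩⟩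
  · intro a ha b hb hab
    obtain ⟨h1, h2, h3⟩ := crosses_iff.1 hab
    exact hmc _ _ _ _ (Finset.mem_filter.1 ha).2 (Finset.mem_filter.1 hb).2 h1 h2 h3
  · rw [sum_smul_arcPoint, hmat]
    exact Prod.ext (funext hrow) (funext hcol)

/-! ### Unit flows along routes -/

lemma forall_mem_zip_tail {α : Type*} {r : α → α → Prop} :
    ∀ {l : List α}, l.IsChain r → ∀ e ∈ l.zip l.tail, r e.1 e.2
  | [], _, e, he => by simp at he
  | [a], _, e, he => by simp at he
  | a :: b :: l, h, e, he => by
    rw [List.isChain_cons_cons] at h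
    rcases List.mem_cons.1 he with rfl | he
    · exact h.1
    · exact forall_mem_zip_tail h.2 e he

lemma nodup_zip_tail {α : Type*} : ∀ {l : List α}, l.Nodup → (l.zip l.tail).Nodup
  | [], _ => by simp
  | [a], _ => by simp
  | a :: b :: l, h => by
    rw [List.nodup_cons] at h
    refine List.nodup_cons.2 ⟨fun hm => h.1 (List.of_mem_zip hm).1, nodup_zip_tail h.2⟩

lemma sum_zip_tail {α : Type*} (f : α → ℝ) : ∀ (l : List α) {u v : α}, l.head? = some u →
    l.getLast? = some v → ((l.zip l.tail).map fun e => f e.1 - f e.2).sum = f u - f v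
  | [], _, _, h, _ => by simp at h
  | [a], _, _, h, h' => by simp_all
  | a :: b :: l, u, v, h, h' => by
    have ih := sum_zip_tail f (b :: l) rfl (v := v) (by simpa using h')
    simp only [List.head?_cons, Option.some.injEq] at h
    subst h
    simp only [List.tail_cons, List.zip_cons_cons, List.map_cons, List.sum_cons] at ih ⊢
    rw [ih]; ring

lemma mem_zip_tail_concat {α : Type*} {t u : α} : ∀ (l : List α) {w : α}, l.getLast? = some w →
    t ∉ l → ((u, t) ∈ (l ++ [t]).zip (l ++ [t]).tail ↔ u = w)
  | [], _, h, _ => by simp at h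
  | [a], _, h, _ => by simp_all
  | a :: b :: l, w, h, ht => by
    have ih := mem_zip_tail_concat (t := t) (u := u) (b :: l) (w := w) (by simpa using h)
      (fun hh => ht (List.mem_cons_of_mem _ hh))
    have htb : t ≠ b := fun e => ht (by simp [e])
    simp only [List.cons_append, List.tail_cons, List.zip_cons_cons, List.mem_cons,
      Prod.mk.injEq, htb, and_false, false_or] at ih ⊢
    exact ih

section Routes

variable {P : List (Fin n)} {v w : Fin n}

/-- The vertex sequence `s, P, t`. -/
def route (P : List (Fin n)) : List (AugVertex n) := ⊥ :: (P.map innerV ++ [⊤])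

lemma isChain_route (hv : v ∈ I) (hw : w ∈ precSet I J) (hP : IsPath (graphG I J) v w P) :
    (route P).IsChain fun a b => (a, b) ∈ augEdges I J := by
  obtain ⟨h1, h2, h3⟩ := hP
  rw [route, List.isChain_cons, List.isChain_append]
  refine ⟨fun y hy => ?_, ?_, List.isChain_singleton _, fun a ha b hb => ?_⟩
  · simp only [List.head?_append, List.head?_map, h2, Option.map_some, Option.some_or,
      Option.mem_def, Option.some.injEq] at hy
    subst hy
    exact mem_augEdges_bot.2 hv
  · rw [List.isChain_map]
    exact h1.imp fun a b h => mem_augEdges_inner.2 h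
  · simp only [List.getLast?_map, h3, Option.map_some, List.head?_cons, Option.mem_def,
      Option.some.injEq] at ha hb
    subst ha hb
    exact mem_augEdges_top.2 hw

lemma lt_of_mem_augEdges {a b : AugVertex n} (h : (a, b) ∈ augEdges I J) : a < b := by
  unfold augEdges at h
  simp only [Finset.mem_union, Finset.mem_image, Prod.mk.injEq] at h
  rcases h with (⟨e, he, rfl, rfl⟩ | ⟨i, -, rfl, rfl⟩) | ⟨j, -, rfl, rfl⟩
  · have := (mem_graphG.1 he).2.2.1
    simpa [innerV] using this
  · exact WithBot.bot_lt_coe _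
  · exact lt_top_iff_ne_top.2 (innerV_ne_top _)

lemma nodup_route (hv : v ∈ I) (hw : w ∈ precSet I J) (hP : IsPath (graphG I J) v w P) :
    (route P).Nodup :=
  (List.isChain_iff_pairwise.1 ((isChain_route hv hw hP).imp fun _ _ h =>
    lt_of_mem_augEdges h)).imp fun h => h.ne

lemma routeFlow_mem_flowPoly (hv : v ∈ I) (hw : w ∈ precSet I J)
    (hP : IsPath (graphG I J) v w P) : routeFlow I J P ∈ flowPoly I J := by
  classical
  refine mem_flowPolytope_iff.2 ⟨fun e => ?_, fun f => ?_⟩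
  · simp only [routeFlow]; split_ifs <;> norm_num
  · have h1 := sum_zip_tail f (route P) (u := ⊥) (v := ⊤) rfl
      (List.getLast?_concat (l := ⊥ :: P.map innerV))
    have h2 := nodup_zip_tail (nodup_route hv hw hP)
    rw [← h1, ← List.sum_toFinset _ h2]
    have h3 : ((route P).zip (route P).tail).toFinset ⊆ augEdges I J := fun e he =>
      forall_mem_zip_tail (isChain_route hv hw hP) e (List.mem_toFinset.1 he)
    have h4 : ∑ e, routeFlow I J P e * (f e.1.1 - f e.1.2) = ∑ e ∈ augEdges I J,
        (if e ∈ (route P).zip (route P).tail then 1 else 0) * (f e.1 - f e.2) :=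
      Finset.sum_coe_sort (augEdges I J) fun e =>
        (if e ∈ (route P).zip (route P).tail then 1 else 0) * (f e.1 - f e.2)
    rw [h4, ← Finset.sum_subset h3 fun e _ he => by
      rw [if_neg (fun h => he (List.mem_toFinset.2 h)), zero_mul]]
    exact Finset.sum_congr rfl fun e he => by rw [if_pos (List.mem_toFinset.1 he), one_mul]

lemma phi1_routeFlow {j : Fin n} (hv : v ∈ I) (hj : j ∈ J)
    (hP : IsPath (graphG I J) v (prec I J j) P) :
    phi1 I J (routeFlow I J P) = arcPoint (v, j) := by
  classical
  have hw : prec I J j ∈ precSet I J := Finset.mem_image_of_mem _ hj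
  have hext : ∀ e, extendZero (routeFlow I J P) e =
      if e ∈ (route P).zip (route P).tail then 1 else 0 := by
    intro e
    unfold extendZero
    split_ifs with h1 h2 h2
    · exact if_pos h2
    · exact if_neg h2
    · exact absurd (forall_mem_zip_tail (isChain_route hv hw hP) e h2) h1
    · rfl
  have hnd := nodup_route hv hw hP
  obtain ⟨h1, h2, h3⟩ := hP
  obtain ⟨P', rfl⟩ : ∃ P', P = v :: P' := by
    cases P with
    | nil => simp at h2
    | cons a P' => simp only [List.head?_cons, Option.some.injEq] at h2; exact ⟨P', by rw [h2]⟩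
  have hzip : (route (v :: P')).zip (route (v :: P')).tail = (⊥, innerV v) ::
      ((v :: P').map innerV ++ [⊤]).zip ((v :: P').map innerV ++ [⊤]).tail := rfl
  ext k
  · rw [phi1_fst, hext, hzip]
    have hb : (⊥, innerV k) ∉ ((v :: P').map innerV ++ [⊤]).zip
        ((v :: P').map innerV ++ [⊤]).tail := fun hm =>
      (List.nodup_cons.1 hnd).1 (List.of_mem_zip hm).1
    simp only [List.mem_cons, hb, or_false, Prod.mk.injEq, true_and, innerV_injective.eq_iff,
      arcPoint, Pi.single_apply]
  · rw [phi1_snd, hext, hzip]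
    have hlast := mem_zip_tail_concat (t := (⊤ : AugVertex n)) (u := innerV (prec I J k))
      ((v :: P').map innerV) (w := innerV (prec I J j)) (by rw [List.getLast?_map, h3]; rfl)
      (fun h => by
        obtain ⟨i, -, hi⟩ := List.mem_map.1 h
        exact innerV_ne_top i hi)
    simp only [List.mem_cons, hlast, arcPoint, Pi.single_apply, Prod.mk.injEq, innerV_ne_bot,
      false_and, false_or, innerV_injective.eq_iff]
    by_cases hk : k ∈ J
    · rw [if_pos hk]
      exact if_congr ⟨fun h => prec_injOn I J hk hj h, fun h => by rw [h]⟩ rfl rfl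
    · rw [if_neg hk, if_neg]
      rintro rfl; exact hk hj

end Routes

/-! ### Arcs as routes -/

lemma Reach.exists_isPath {N : Finset (Fin n × Fin n)} {v w : Fin n} (h : Reach N v w) :
    ∃ P, IsPath N v w P := by
  obtain ⟨l, h1, h2⟩ := List.exists_isChain_cons_of_relationReflTransGen h.to_reflTransGen
  exact ⟨v :: l, h1, rfl, by rw [List.getLast?_eq_some_getLast (List.cons_ne_nil _ _), h2]⟩

lemma isPath_singleton (N : Finset (Fin n × Fin n)) (v : Fin n) : IsPath N v v [v] :=
  ⟨List.isChain_singleton _, rfl, rfl⟩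

lemma arcs_left_mem (a : arcs I J) : a.1.1 ∈ I := (mem_arcs.1 a.2).1

lemma arcs_right_mem (a : arcs I J) : a.1.2 ∈ J := (mem_arcs.1 a.2).2.1

lemma arcs_le_prec (a : arcs I J) : a.1.1 ≤ prec I J a.1.2 :=
  (le_prec_iff (arcs_left_mem a) _).2 (mem_arcs.1 a.2).2.2

lemma prec_mem_precSet (a : arcs I J) : prec I J a.1.2 ∈ precSet I J :=
  Finset.mem_image_of_mem _ (arcs_right_mem a)

lemma exists_isPath_arc (a : arcs I J) :
    ∃ P, IsPath (graphG I J) a.1.1 (prec I J a.1.2) P := by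
  rcases (arcs_le_prec a).eq_or_lt with h | h
  · exact ⟨[a.1.1], by rw [← h]; exact isPath_singleton _ _⟩
  · exact (reach_graphG (arcs_left_mem a) (prec_mem_precSet a) h).exists_isPath

/-- The unit flow along the route `s, P, t`, where `P` is the path of `G(I, J̄)` from `i` to
`prec(j̄)`, for the arc `(i, j̄)`. -/
def arcFlow (a : arcs I J) : augEdges I J → ℝ := routeFlow I J (exists_isPath_arc a).choose

lemma phi1_arcFlow (a : arcs I J) : phi1 I J (arcFlow a) = arcPoint a.1 :=
  phi1_routeFlow (arcs_left_mem a) (arcs_right_mem a) (exists_isPath_arc a).choose_spec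

lemma arcFlow_mem_flowPoly (a : arcs I J) : arcFlow a ∈ flowPoly I J :=
  routeFlow_mem_flowPoly (arcs_left_mem a) (prec_mem_precSet a) (exists_isPath_arc a).choose_spec

lemma routeFlow_eq_arcFlow (a : arcs I J) {P : List (Fin n)}
    (hP : IsPath (graphG I J) a.1.1 (prec I J a.1.2) P) : routeFlow I J P = arcFlow a :=
  injOn_phi1 I J (routeFlow_mem_flowPoly (arcs_left_mem a) (prec_mem_precSet a) hP)
    (arcFlow_mem_flowPoly a)
    ((phi1_routeFlow (arcs_left_mem a) (arcs_right_mem a) hP).trans (phi1_arcFlow a).symm)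

lemma phi1_sum_arcFlow (x : arcs I J → ℝ) :
    phi1 I J (∑ a, x a • arcFlow a) = ∑ a, x a • arcPoint a.1 := by
  simp only [map_sum, map_smul, phi1_arcFlow]

lemma uniqueCombinations_arcFlow (I J : Finset (Fin n)) :
    UniqueCombinations (tamariComplex I J) (arcFlow (I := I) (J := J)) := by
  intro F hF F' hF' x y hx hy hxF hyF' hxy
  refine uniqueCombinations_arcPoint I J F hF F' hF' x y hx hy hxF hyF' ?_
  rw [← phi1_sum_arcFlow, ← phi1_sum_arcFlow, hxy]

lemma convex_flowPolytope {V : Type*} [DecidableEq V] [Fintype V] (E : Finset (V × V)) (s t : V) :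
    Convex ℝ (flowPolytope E s t) := by
  intro x hx y hy a b ha hb hab
  rw [mem_flowPolytope_iff] at hx hy ⊢
  refine ⟨fun e => add_nonneg (mul_nonneg ha (hx.1 e)) (mul_nonneg hb (hy.1 e)), fun f => ?_⟩
  calc ∑ e, (a • x + b • y) e * (f e.1.1 - f e.1.2)
      = a * ∑ e, x e * (f e.1.1 - f e.1.2) + b * ∑ e, y e * (f e.1.1 - f e.1.2) := by
        rw [Finset.mul_sum, Finset.mul_sum, ← Finset.sum_add_distrib]
        refine Finset.sum_congr rfl fun e _ => ?_
        simp only [Pi.add_apply, Pi.smul_apply, smul_eq_mul]; ring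
    _ = f s - f t := by rw [hx.2, hy.2, ← add_mul, hab, one_mul]

lemma sum_arcFlow_mem {x : arcs I J → ℝ} (hx : ∀ a, 0 ≤ x a) (hsum : ∑ a, x a = 1) :
    ∑ a, x a • arcFlow a ∈ flowPoly I J :=
  (convex_flowPolytope _ _ _).sum_mem (fun a _ => hx a) hsum fun a _ => arcFlow_mem_flowPoly a

lemma mem_polytopeU_iff {z : (Fin n → ℝ) × (Fin n → ℝ)} : z ∈ polytopeU I J ↔
    ∃ x : arcs I J → ℝ, (∀ a, 0 ≤ x a) ∧ ∑ a, x a = 1 ∧ ∑ a, x a • arcPoint a.1 = z := by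
  classical
  have h : arcPoint '' (arcs I J : Set (Fin n × Fin n)) =
      ((Finset.univ.image fun a : arcs I J => arcPoint a.1 : Finset _) : Set _) := by
    ext y
    simp
  rw [polytopeU, h]
  rw [mem_convexHull_image_iff (uniqueCombinations_arcPoint I J).injective]
  simp only [Finset.mem_univ, implies_true, true_and]

lemma bijOn_phi1 (I J : Finset (Fin n)) : Set.BijOn (phi1 I J) (flowPoly I J) (polytopeU I J) := by
  refine ⟨fun x hx => ?_, injOn_phi1 I J, fun z hz => ?_⟩
  · obtain ⟨F, -, y, h1, -, h2, h3⟩ := exists_forest_combination hx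
    exact mem_polytopeU_iff.2 ⟨y, h1, h2, h3⟩
  · obtain ⟨x, h1, h2, rfl⟩ := mem_polytopeU_iff.1 hz
    exact ⟨_, sum_arcFlow_mem h1 h2, phi1_sum_arcFlow x⟩

lemma space_arcFlow (I J : Finset (Fin n)) :
    (uniqueCombinations_arcFlow I J).complex.space = flowPoly I J := by
  ext z
  rw [UniqueCombinations.mem_space_iff]
  constructor
  · rintro ⟨F, -, x, h1, -, h2, rfl⟩
    exact sum_arcFlow_mem h1 h2
  · intro hz
    obtain ⟨F, hF, y, h1, h2, h3, h4⟩ := exists_forest_combination hz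
    refine ⟨F, hF, y, h1, h2, h3, injOn_phi1 I J (sum_arcFlow_mem h1 h3) hz ?_⟩
    rw [phi1_sum_arcFlow, h4]

lemma space_arcPoint (I J : Finset (Fin n)) :
    (uniqueCombinations_arcPoint I J).complex.space = polytopeU I J := by
  ext z
  rw [UniqueCombinations.mem_space_iff]
  constructor
  · rintro ⟨F, -, x, h1, -, h2, h3⟩
    exact mem_polytopeU_iff.2 ⟨x, h1, h2, h3⟩
  · intro hz
    obtain ⟨x, hx, rfl⟩ := (bijOn_phi1 I J).surjOn hz
    exact exists_forest_combination hx

/-! ### The simplices encoded by a reduced form -/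

/-- The arcs whose routes span the polytope of `N`: those standing for the edges of `N`, and those
standing for the vertices which are both sources and sinks. -/
def arcsOf (I J : Finset (Fin n)) (N : Finset (Fin n × Fin n)) : Finset (arcs I J) :=
  Finset.univ.filter fun a => (a.1.1, prec I J a.1.2) ∈ N ∨ a.1.1 = prec I J a.1.2

lemma mem_arcsOf {N : Finset (Fin n × Fin n)} {a : arcs I J} :
    a ∈ arcsOf I J N ↔ (a.1.1, prec I J a.1.2) ∈ N ∨ a.1.1 = prec I J a.1.2 := by
  simp [arcsOf]

lemma exists_arc {v w : Fin n} (hv : v ∈ I) (hw : w ∈ precSet I J) (h : v ≤ w) :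
    ∃ a : arcs I J, a.1.1 = v ∧ prec I J a.1.2 = w := by
  obtain ⟨j, hj, rfl⟩ := Finset.mem_image.1 hw
  exact ⟨⟨(v, j), mem_arcs.2 ⟨hv, hj, (le_prec_iff hv j).1 h⟩⟩, rfl, rfl⟩

lemma arc_ext {a b : arcs I J} (h1 : a.1.1 = b.1.1)
    (h2 : prec I J a.1.2 = prec I J b.1.2) : a = b :=
  Subtype.ext (Prod.ext h1 (prec_injOn I J (arcs_right_mem a) (arcs_right_mem b) h2))

lemma crosses_iff_prec {a b : arcs I J} : Crosses a.1 b.1 ↔ a.1.1 < b.1.1 ∧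
    b.1.1 ≤ prec I J a.1.2 ∧ prec I J a.1.2 < prec I J b.1.2 := by
  rw [crosses_iff, le_prec_iff (arcs_left_mem b), prec_lt_prec_iff (arcs_right_mem a)
    (arcs_right_mem b)]

namespace IsNoncrossingForest

variable {N : Finset (Fin n × Fin n)}

lemma spanningRoutes_eq (hN : IsNoncrossingForest I J N) :
    spanningRoutes I J N = arcFlow '' (arcsOf I J N : Set (arcs I J)) := by
  ext x
  constructor
  · rintro (⟨⟨v, w⟩, he, P, hP, rfl⟩ | ⟨i, hi, hiW, rfl⟩)
    · obtain ⟨a, rfl, rfl⟩ := exists_arc (hN.left_mem he) (hN.right_mem he) (hN.lt he).le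
      exact ⟨a, mem_arcsOf.2 (Or.inl he), (routeFlow_eq_arcFlow a hP).symm⟩
    · obtain ⟨a, rfl, h⟩ := exists_arc hi hiW le_rfl
      refine ⟨a, mem_arcsOf.2 (Or.inr h.symm), (routeFlow_eq_arcFlow a ?_).symm⟩
      rw [h]; exact isPath_singleton _ _
  · rintro ⟨a, ha, rfl⟩
    rcases mem_arcsOf.1 ha with h | h
    · exact Or.inl ⟨_, h, _, (exists_isPath_arc a).choose_spec, rfl⟩
    · refine Or.inr ⟨a.1.1, arcs_left_mem a, h ▸ prec_mem_precSet a, ?_⟩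
      refine (routeFlow_eq_arcFlow a ?_).symm
      rw [← h]; exact isPath_singleton _ _

lemma card_arcsOf (hN : IsNoncrossingForest I J N) :
    (arcsOf I J N).card = N.card + (I ∩ precSet I J).card := by
  classical
  have hinj : Function.Injective fun a : arcs I J => (a.1.1, prec I J a.1.2) := fun a b h =>
    arc_ext (Prod.mk.inj h).1 (Prod.mk.inj h).2
  have hdiag : Function.Injective fun v : Fin n => (v, v) := fun v w h => (Prod.mk.inj h).1
  rw [← Finset.card_image_of_injective _ hinj, ← Finset.card_image_of_injective (I ∩ _) hdiag,
    ← Finset.card_union_of_disjoint]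
  · congr 1
    ext ⟨v, w⟩
    simp only [Finset.mem_image, Finset.mem_union, mem_arcsOf, Finset.mem_inter, Prod.mk.injEq]
    constructor
    · rintro ⟨a, h | h, rfl, rfl⟩
      · exact Or.inl h
      · exact Or.inr ⟨a.1.1, ⟨arcs_left_mem a, h ▸ prec_mem_precSet a⟩, rfl, h⟩
    · rintro (h | ⟨u, ⟨h1, h2⟩, rfl, rfl⟩)
      · obtain ⟨a, rfl, rfl⟩ := exists_arc (hN.left_mem h) (hN.right_mem h) (hN.lt h).le
        exact ⟨a, Or.inl h, rfl, rfl⟩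
      · obtain ⟨a, h3, h4⟩ := exists_arc h1 h2 le_rfl
        exact ⟨a, Or.inr (h3.trans h4.symm), h3, h4⟩
  · rw [Finset.disjoint_left]
    rintro e he he'
    obtain ⟨v, -, rfl⟩ := Finset.mem_image.1 he'
    exact lt_irrefl _ (hN.lt he)

/-- The arcs of an alternating noncrossing forest form an `(I, J̄)`-forest. -/
lemma isForest_arcsOf (hN : IsNoncrossingForest I J N)
    (halt : ∀ i j k, ¬ NonAlternating N i j k) : IsForest (arcsOf I J N) := by
  intro a ha b hb hab
  obtain ⟨h1, h2, h3⟩ := crosses_iff_prec.1 hab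
  have ha' := (mem_arcsOf.1 ha).resolve_right (h1.trans_le h2).ne
  have hb' := (mem_arcsOf.1 hb).resolve_right (h2.trans_lt h3).ne
  rcases h2.eq_or_lt with h | h
  · exact halt _ _ _ ⟨hN.lt ha', h ▸ hN.lt hb', ha', h ▸ hb'⟩
  · exact hN.noncrossing ha' hb' h1 h h3

end IsNoncrossingForest

namespace IsPartialReduction

variable {p : SubdivPoly n}

/-- Every `(I, J̄)`-forest lies in one given by a monomial of highest degree. -/
lemma exists_subset_arcsOf (hp : IsPartialReduction I J p) (hred : IsReduced p)
    {F : Finset (arcs I J)} (hF : IsForest F) : ∃ m ∈ p.support,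
      (graphOf m).card = (graphG I J).card ∧ F ⊆ arcsOf I J (graphOf m) := by
  obtain ⟨m, hm, hcard, hreach⟩ := hp.cover
    {e | ∃ a ∈ F, e = (a.1.1, prec I J a.1.2) ∧ a.1.1 < prec I J a.1.2}
    (by rintro _ ⟨a, -, rfl, h⟩; exact ⟨arcs_left_mem a, prec_mem_precSet a, h⟩)
    (by
      rintro _ ⟨a, ha, rfl, -⟩ _ ⟨b, hb, rfl, -⟩ h1 h2 h3
      exact hF a ha b hb (crosses_iff_prec.2 ⟨h1, h2, h3⟩))
  refine ⟨m, hm, hcard, fun a ha => mem_arcsOf.2 ?_⟩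
  rcases (arcs_le_prec a).eq_or_lt with h | h
  · exact Or.inr h
  · exact Or.inl ((hp.forest m hm).mem_of_reach (hred m hm) (hreach _ ⟨a, ha, rfl, h⟩))

/-- The complex of the routes of the `(I, J̄)`-forests is the one encoded by a reduced form; its
facets come from the monomials of highest degree since these already cover all forests. -/
lemma isEncodedTriangulation (hp : IsPartialReduction I J p) (hred : IsReduced p)
    (hIJ : Valid I J) :
    IsEncodedTriangulation I J p (uniqueCombinations_arcFlow I J).complex := by
  have hT := uniqueCombinations_arcFlow I J
  have hspan : ∀ m ∈ p.support, spanningRoutes I J (graphOf m) =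
      arcFlow '' (arcsOf I J (graphOf m) : Set (arcs I J)) := fun m hm =>
    (hp.forest m hm).spanningRoutes_eq
  have hface : ∀ m ∈ p.support, arcsOf I J (graphOf m) ∈ (tamariComplex I J).faces := by
    intro m hm
    obtain ⟨b, hb, hbW⟩ := hIJ.exists_mem_inter
    obtain ⟨a, h1, h2⟩ := exists_arc hb hbW le_rfl
    exact ⟨⟨a, mem_arcsOf.2 (Or.inr (h1.trans h2.symm))⟩,
      (hp.forest m hm).isForest_arcsOf (hred m hm)⟩
  have hfaces : ∀ σ, σ ∈ hT.complex.faces ↔ σ.Nonempty ∧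
      ∃ m ∈ p.support, (σ : Set _) ⊆ spanningRoutes I J (graphOf m) := by
    intro σ
    constructor
    · intro hσ
      refine ⟨hT.complex.nonempty_of_mem_faces hσ, ?_⟩
      obtain ⟨F, ⟨-, hF⟩, hσF⟩ := hT.mem_faces_iff.1 hσ
      obtain ⟨m, hm, -, hsub⟩ := hp.exists_subset_arcsOf hred hF
      refine ⟨m, hm, ?_⟩
      rw [hσF, hspan m hm]
      exact Set.image_mono (Finset.coe_subset.2 hsub)
    · rintro ⟨hne, m, hm, hsub⟩
      exact hT.mem_faces_of_subset (hface m hm) hne (hspan m hm ▸ hsub)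
  refine ⟨space_arcFlow I J, Set.ext hfaces, ?_⟩
  ext σ
  rw [Set.mem_ofPred_eq, Geometry.SimplicialComplex.facets, Set.mem_ofPred_eq]
  constructor
  · rintro ⟨hσ, hmax⟩
    obtain ⟨F, ⟨-, hF⟩, hσF⟩ := hT.mem_faces_iff.1 hσ
    obtain ⟨m, hm, hcard, hsub⟩ := hp.exists_subset_arcsOf hred hF
    obtain ⟨τ, hτ, hτm⟩ := hT.exists_mem_faces (hface m hm)
    refine ⟨m, hm, (degree_eq_card (hp.squarefree m hm)).trans hcard, ?_⟩
    rw [hspan m hm, ← hτm, Finset.coe_inj]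
    refine hmax hτ (Finset.coe_subset.1 ?_)
    rw [hσF, hτm]
    exact Set.image_mono (Finset.coe_subset.2 hsub)
  · rintro ⟨m, hm, hdeg, hσ⟩
    rw [degree_eq_card (hp.squarefree m hm)] at hdeg
    have hσ' := hσ.trans (hspan m hm)
    refine ⟨hT.mem_faces_iff.2 ⟨_, hface m hm, hσ'⟩, fun τ hτ hsub => ?_⟩
    obtain ⟨-, m', hm', hsub'⟩ := (hfaces τ).1 hτ
    obtain ⟨ρ, -, hρ⟩ := hT.exists_mem_faces (hface m' hm')
    rw [hspan m' hm', ← hρ, Finset.coe_subset] at hsub'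
    -- all simplices of highest degree have the same number of vertices
    refine Finset.eq_of_subset_of_card_le hsub ((Finset.card_le_card hsub').trans ?_)
    rw [hT.card_eq hρ, hT.card_eq hσ', (hp.forest m hm).card_arcsOf,
      (hp.forest m' hm').card_arcsOf, hdeg]
    exact Nat.add_le_add_right (hp.card_le m' hm') _

end IsPartialReduction

end IJTamari

end

open IJTamari
theorem theorem4p6 {n : ℕ} (I J : Finset (Fin n)) (hIJ : Valid I J) :
    (∃ p : SubdivPoly n, IsLengthReducedForm I J p) ∧
    ∀ p : SubdivPoly n, (IsLengthReducedForm I J p ∨ IsLongestPairReducedForm I J p) →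
      ∃ (T : Geometry.SimplicialComplex ℝ (augEdges I J → ℝ))
        (A : Geometry.SimplicialComplex ℝ ((Fin n → ℝ) × (Fin n → ℝ))),
        IsEncodedTriangulation I J p T ∧
        IsAssociahedralTriangulation I J A ∧
        CarriesTo (phi1 I J) T (flowPoly I J) A (polytopeU I J) ∧
        IsGeometricRealization (tamariComplex I J) T := by
  refine ⟨exists_isLengthReducedForm I J, fun p hp => ?_⟩
  have hp : IsLongestPairReducedForm I J p := hp.elim (fun h => h.isLongestPairReducedForm) id
  have hT := uniqueCombinations_arcFlow I J
  have hA := uniqueCombinations_arcPoint I J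
  exact ⟨hT.complex, hA.complex, hp.isPartialReduction.isEncodedTriangulation hp.2 hIJ,
    ⟨space_arcPoint I J, hA.faces_complex⟩, ⟨bijOn_phi1 I J, hT.faces_map hA phi1_arcFlow⟩,
    hT.isGeometricRealization⟩
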